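/- Let $r\ge 3$, $q=2^r$, and let $\mathbb F_q$ be the field with $q$ elements. Let $tr:\mathbb F_q\to\mathbb F_2$ be the absolute trace and $\lambda(x)=(-1)^{tr(x)}$ the canonical additive character. For $m\ge1$ and $a\in\mathbb F_q^*$ put $$K_m(\lambda;a)=\sum_{\alpha_1,\dots,\alpha_m\in\mathbb F_q^*}\lambda(\alpha_1+\cdots+\alpha_m+a\alpha_1^{-1}\cdots\alpha_m^{-1}),\qquad MK_m^h=\sum_{a\in\mathbb F_q^*}K_m(\lambda;a)^h\quad(h\ge0),$$ and $K=K_1$, $MK^h=MK_1^h$. For $k\ge 1$ let $C_k$ (respectively $D_k$) be the binary linear code of all $u\in\mathbb F_2^{(q-1)^k}$, with coordinates indexed by $(\alpha_1,\dots,\alpha_k)\in(\mathbb F_q^*)^k$, whose usual inner product in $\mathbb F_q^{(q-1)^k}$ with the vector $(\alpha_1+\cdots+\alpha_k+\alpha_1^{-1}\cdots\alpha_k^{-1})_{\alpha}$ (respectively $(\alpha_1+\cdots+\alpha_k+\alpha_1^{-1}+\cdots+\alpha_k^{-1})_{\alpha}$) is $0$. Let $C_{k,j}$ (respectively $D_{k,j}$)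 be the number of codewords of Hamming weight $j$ in it. $S(h,t)$ denotes the Stirling number of the second kind, and $\binom{n}{k}=0$ for $k<0$. Below, $t$ as an index of a product runs over all integers with $|t|<2\sqrt q$ and $t\equiv-1\pmod 4$, and $\prod_{K(\lambda;\beta^{-1})=t}$ is over the $\beta\in\mathbb F_q^*$ with $K(\lambda;\beta^{-1})=t$. (1) For all $h\ge1$, $$MK^{h}=\sum_{l=0}^{h-1}(-1)^{h+l+1}\binom hl(q-1)^{h-l}MK^{l}+q\sum_{j=0}^{\min\{q-1,h\}}(-1)^{h+j}C_{1,j}\sum_{t=j}^{h}t!\,S(h,t)2^{h-t}\binom{q-1-j}{q-1-t},$$ and for $0\le j\le q-1$ $$C_{1,j}=\sum\binom1{\nu_0}\prod_{\beta\in\mathbb F_q^*,\ tr(\beta^{-1})=0}\binom2{\nu_\beta},$$ the sum being over all families of nonnegative integers $\nu_0$, $\nu_\beta$ ($\beta\in\mathbb F_q^*$, $tr(\beta^{-1})=0$) with $\nu_0+\sum\nu_\beta=j$ and $\sum\nu_\beta\beta=0$ in $\mathbb F_q$. (2) For all $h\ge1$, $$MK_3^{h}=\sum_{l=0}^{h-1}(-1)^{h+l+1}\binom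 hl(q-1)^{3(h-l)}MK_3^{l}+q\sum_{j=0}^{\min\{(q-1)^3,h\}}(-1)^{h+j}C_{3,j}\sum_{t=j}^{h}t!\,S(h,t)2^{h-t}\binom{(q-1)^3-j}{(q-1)^3-t},$$ and for $0\le j\le(q-1)^3$ $$C_{3,j}=\sum\binom{m_0}{\nu_0}\prod_{t}\ \prod_{K(\lambda;\beta^{-1})=t}\binom{m_t}{\nu_\beta},\qquad m_0=q^2-3q+3,\quad m_t=t^2+q^2-4q+3,$$ the sum being over all families $(\nu_\beta)_{\beta\in\mathbb F_q}$ of nonnegative integers with $$\sum_{\beta\in\mathbb F_q}\nu_\beta=j\quad\text{and}\quad\sum_{\beta\in\mathbb F_q}\nu_\beta\beta=0\ \text{ in }\mathbb F_q.\tag{$*$}$$ (3) For all $h\ge1$, $$MK^{2h}=\sum_{l=0}^{h-1}(-1)^{h+l+1}\binom hl(q-1)^{2(h-l)}MK^{2l}+q\sum_{j=0}^{\min\{(q-1)^2,h\}}(-1)^{h+j}D_{2,j}\sum_{t=j}^{h}t!\,S(h,t)2^{h-t}\binom{(q-1)^2-j}{(q-1)^2-t},$$ and for $0\le j\le(q-1)^2$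 $$D_{2,j}=\sum\binom{2q-3}{\nu_0}\prod_{\beta\in\mathbb F_q^*}\binom{K(\lambda;\beta^{-1})+q-3}{\nu_\beta}=\sum\binom{2q-3}{\nu_0}\prod_{t}\ \prod_{K(\lambda;\beta^{-1})=t}\binom{t+q-3}{\nu_\beta},$$ both sums being over all families $(\nu_\beta)_{\beta\in\mathbb F_q}$ of nonnegative integers satisfying $(*)$. (4) For all $h\ge1$, with the same $D_{2,j}$, $$MK_2^{h}=\sum_{l=0}^{h-1}(-1)^{h+l+1}\binom hl(q^2-3q+1)^{h-l}MK_2^{l}+q\sum_{j=0}^{\min\{(q-1)^2,h\}}(-1)^{h+j}D_{2,j}\sum_{t=j}^{h}t!\,S(h,t)2^{h-t}\binom{(q-1)^2-j}{(q-1)^2-t}.$$ -/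

import Mathlib

open scoped Nat

namespace KloostermanMoments

noncomputable section

/-- The binomial coefficient `n.choose k` for integers `n` and `k`; it is `0` for `k < 0`. -/
def binom (n k : ℤ) : ℤ := if 0 ≤ k then Ring.choose n k.toNat else 0

section Sums

variable {F : Type*} [Field F] [Fintype F] [DecidableEq F] [Algebra (ZMod 2) F]

/-- The absolute trace `tr : F → 𝔽₂`. -/
def tr (x : F) : ZMod 2 := Algebra.trace (ZMod 2) F x

/-- The canonical additive character `λ(x) = (-1) ^ tr x`; its values are `1` and `-1`. -/
def lam (x : F) : ℤ := (-1) ^ (tr x).val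

/-- The `m`-dimensional Kloosterman sum
`K_m(λ; a) = ∑ λ(α₁ + ⋯ + α_m + a α₁⁻¹ ⋯ α_m⁻¹)` over `α₁, …, α_m ∈ F*`. -/
def K (m : ℕ) (a : Fˣ) : ℤ :=
  ∑ α : Fin m → Fˣ, lam (∑ i, (α i : F) + (a : F) * ∏ i, (α i : F)⁻¹)

variable (F) in
/-- The moment `MK_m ^ h = ∑_{a ∈ F*} K_m(λ; a) ^ h`. -/
def MK (m h : ℕ) : ℤ := ∑ a : Fˣ, K m a ^ h

end Sums

section Codes

variable {F : Type*} [Field F] [Algebra (ZMod 2) F]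

/-- The binary linear code of all `u ∈ 𝔽₂^ι` whose usual inner product with `v ∈ F^ι` is `0`. -/
def binaryCode {ι : Type*} [Fintype ι] (v : ι → F) : Submodule (ZMod 2) (ι → ZMod 2) where
  carrier := {u | ∑ i, algebraMap (ZMod 2) F (u i) * v i = 0}
  zero_mem' := by simp
  add_mem' := by
    intro x y hx hy
    simp only [Set.mem_ofPred_eq] at hx hy ⊢
    simp [add_mul, Finset.sum_add_distrib, hx, hy]
  smul_mem' := by
    intro c x hx
    simp only [Set.mem_ofPred_eq] at hx ⊢
    simp [mul_assoc, ← Finset.mul_sum, hx]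

/-- The number of codewords of Hamming weight `j` in a binary code. -/
def weightCount {ι : Type*} [Fintype ι] (B : Submodule (ZMod 2) (ι → ZMod 2)) (j : ℕ) : ℕ :=
  Nat.card {u : ι → ZMod 2 // u ∈ B ∧ hammingNorm u = j}

variable (F) [Fintype F] [DecidableEq F]

/-- The code `C_k` of length `(q - 1) ^ k`, with coordinates indexed by `(F*)^k`, attached to the
vector with entries `α₁ + ⋯ + α_k + α₁⁻¹ ⋯ α_k⁻¹`. -/
def codeC (k : ℕ) : Submodule (ZMod 2) ((Fin k → Fˣ) → ZMod 2) :=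
  binaryCode fun α => ∑ i, (α i : F) + ∏ i, (α i : F)⁻¹

/-- The code `D_m` of length `(q - 1) ^ m`, with coordinates indexed by `(F*)^m`, attached to the
vector with entries `α₁ + ⋯ + α_m + α₁⁻¹ + ⋯ + α_m⁻¹`. -/
def codeD (m : ℕ) : Submodule (ZMod 2) ((Fin m → Fˣ) → ZMod 2) :=
  binaryCode fun α => ∑ i, (α i : F) + ∑ i, (α i : F)⁻¹

end Codes

section Families

variable {F : Type*} [Field F] [Fintype F] [DecidableEq F]

/-- The families `(ν_β)_{β ∈ S}` of nonnegative integers (extended by `0` outside `S`) with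
`∑ ν_β = j` and `∑ ν_β β = 0`. -/
def families (S : Finset F) (j : ℕ) : Finset (F → ℕ) :=
  (S.piAntidiag j).filter fun ν => ∑ β ∈ S, (ν β : F) * β = 0

variable (F) in
/-- The nonzero `β` with `tr (β⁻¹) = 0`. -/
def traceZero [Algebra (ZMod 2) F] : Finset F :=
  Finset.univ.filter fun β => β ≠ 0 ∧ tr β⁻¹ = 0

end Families

/-- The integers `t` with `|t| < 2 √q` and `t ≡ -1 (mod 4)`; see `mem_valueRange`. -/
def valueRange (q : ℕ) : Finset ℤ :=
  (Finset.Icc (-(2 * q : ℤ)) (2 * q)).filter fun t =>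
    |(t : ℝ)| < 2 * √(q : ℝ) ∧ t ≡ -1 [ZMOD 4]

theorem mem_valueRange (q : ℕ) (t : ℤ) :
    t ∈ valueRange q ↔ |(t : ℝ)| < 2 * √(q : ℝ) ∧ t ≡ -1 [ZMOD 4] := by
  simp only [valueRange, Finset.mem_filter, Finset.mem_Icc, and_iff_right_iff_imp]
  rintro ⟨h, -⟩
  have h1 : √(q : ℝ) ≤ q := by
    rw [Real.sqrt_le_left (by positivity)]
    exact_mod_cast Nat.le_self_pow two_ne_zero q
  have h2 : |(t : ℝ)| ≤ 2 * q := by linarith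
  rw [abs_le] at h2
  exact ⟨by exact_mod_cast h2.1, by exact_mod_cast h2.2⟩

end

end KloostermanMoments

/-! For a vector `v` with `N` entries in `F`, `∑ i, lam (a * v i)` is `N` minus twice the weight of
`(tr (a * v i))_i`. Expanding the `h`-th power of this weight in binomial coefficients (Stirling
numbers) and applying orthogonality in `a` turns the sum over `a` into counts of subsets on which
`v` sums to zero, i.e. codewords of the binary code of `v`: this is `sum_charSum_sub_card_pow`. The
recursions follow because these character sums are Kloosterman sums. Scaling gives `K k (x ^ (k +
1))` for `codeC`, which is `K k x` when `k + 1` is a power of two (`sum_lam_codeC`,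
`K_pow_two_pow`), and `codeD F 2` gives `K 1 x ^ 2`. Carlitz's identity `K_one_sq` passes from `K 1`
to `K 2`.

The weight formulas sort the support of a codeword by the values of `v`, so they need only the fibre
sizes of `v`; Fourier inversion computes these from lower Kloosterman sums.

Grouping the factors by `t = K 1 β⁻¹` requires every value to lie in `valueRange`. The congruence
mod 4 comes from an involution. The bound is Manin's elementary argument: on a twisted elliptic
curve over `F(X)`, add multiples of `(X, 0)` to its Frobenius image. The heights of the
`x`-coordinates are bounded by a quadratic in `n` with linear coefficient `-K 1 a`; heights are
nonnegative, hence so is the quadratic. -/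

namespace KloostermanMoments

/-! ### Heights along an arithmetic progression of points -/

section Heights

open Polynomial

variable {F : Type*} [Field F]

/-- The symmetric biquadratic form relating the `x`-coordinates `f₀ / g₀` of `P` and `f₁ / g₁` of
`P ± (X, 0)` on the curve `y² + x y = x³ + (X + b / X²) x² + b` over `F(X)`. -/
noncomputable def biquadratic (b : F) (f₀ g₀ f₁ g₁ : F[X]) : F[X] :=
  f₀ ^ 2 * f₁ ^ 2 + X ^ 2 * (f₀ ^ 2 * g₁ ^ 2 + g₀ ^ 2 * f₁ ^ 2) + X * f₀ * g₀ * f₁ * g₁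
    + C b * g₀ ^ 2 * g₁ ^ 2

/-- The height of the projective point `[f : g]` when `f` and `g` are coprime. -/
def height (f g : F[X]) : ℕ := max f.natDegree g.natDegree

theorem coeff_height_ne_zero {f g : F[X]} (h : ¬(f = 0 ∧ g = 0)) :
    ¬(f.coeff (height f g) = 0 ∧ g.coeff (height f g) = 0) := by
  rintro ⟨hf, hg⟩
  unfold height at hf hg
  rcases lt_trichotomy f.natDegree g.natDegree with hlt | heq | hlt
  · rw [max_eq_right hlt.le] at hg
    have : g = 0 := by simpa using hg
    simp [this] at hlt
  · rw [heq, max_self] at hg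
    rw [← heq, max_self] at hf
    exact h ⟨by simpa using hf, by simpa using hg⟩
  · rw [max_eq_left hlt.le] at hf
    have : f = 0 := by simpa using hf
    simp [this] at hlt

/-- The height of a quadratic form bounds the sum of the heights of its two roots. -/
theorem height_add_height_le {f₀ g₀ f₂ g₂ : F[X]} {n : ℕ}
    (h₀ : ¬(f₀ = 0 ∧ g₀ = 0)) (h₂ : ¬(f₂ = 0 ∧ g₂ = 0))
    (hA : (g₀ * g₂).natDegree ≤ n) (hB : (f₀ * g₂ + f₂ * g₀).natDegree ≤ n)
    (hC : (f₀ * f₂).natDegree ≤ n) : height f₀ g₀ + height f₂ g₂ ≤ n := by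
  by_contra! hn
  have c₀ := coeff_height_ne_zero h₀
  have c₂ := coeff_height_ne_zero h₂
  have hf₀ : f₀.natDegree ≤ height f₀ g₀ := le_max_left _ _
  have hg₀ : g₀.natDegree ≤ height f₀ g₀ := le_max_right _ _
  have hf₂ : f₂.natDegree ≤ height f₂ g₂ := le_max_left _ _
  have hg₂ : g₂.natDegree ≤ height f₂ g₂ := le_max_right _ _
  have eA := coeff_eq_zero_of_natDegree_lt (hA.trans_lt hn)
  have eB := coeff_eq_zero_of_natDegree_lt (hB.trans_lt hn)
  have eC := coeff_eq_zero_of_natDegree_lt (hC.trans_lt hn)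
  rw [coeff_mul_add_eq_of_natDegree_le hg₀ hg₂] at eA
  rw [coeff_mul_add_eq_of_natDegree_le hf₀ hf₂] at eC
  rw [coeff_add, coeff_mul_add_eq_of_natDegree_le hf₀ hg₂,
    add_comm (height f₀ g₀), coeff_mul_add_eq_of_natDegree_le hf₂ hg₀] at eB
  grind

theorem exists_isCoprime_of_biquadratic_eq_zero {b : F} {f₁ g₁ f g : F[X]}
    (h : ¬(f = 0 ∧ g = 0)) (hΦ : biquadratic b f₁ g₁ f g = 0) :
    ∃ f' g', IsCoprime f' g' ∧ biquadratic b f₁ g₁ f' g' = 0 ∧ height f' g' ≤ height f g := by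
  classical
  have hG : GCDMonoid.gcd f g ≠ 0 := by simpa [gcd_eq_zero_iff] using h
  have hcop := isCoprime_div_gcd_div_gcd_of_gcd_ne_zero hG
  have ef := EuclideanDomain.mul_div_cancel' hG (GCDMonoid.gcd_dvd_left f g)
  have eg := EuclideanDomain.mul_div_cancel' hG (GCDMonoid.gcd_dvd_right f g)
  set G := GCDMonoid.gcd f g
  set f' := f / G
  set g' := g / G
  refine ⟨f', g', hcop, ?_, ?_⟩
  · have : G ^ 2 * biquadratic b f₁ g₁ f' g' = 0 := by
      rw [← hΦ, ← ef, ← eg]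
      unfold biquadratic
      ring
    exact (mul_eq_zero.mp this).resolve_left (pow_ne_zero 2 hG)
  · have hle (p : F[X]) : p.natDegree ≤ (G * p).natDegree := by
      rcases eq_or_ne p 0 with rfl | hp
      · simp
      · rw [natDegree_mul hG hp]; omega
    rw [← ef, ← eg]
    exact max_le_max (hle f') (hle g')

/-- Vieta: for fixed `f₁ / g₁` the form is a quadratic `A f² + B f g + D g²`, whose roots are the
`x`-coordinates of the two neighbours. One root `f₀ / g₀` being known, the other is read off from `A
= g₀ g₂`, `D = f₀ f₂`, `B = f₀ g₂ + f₂ g₀`, and the coefficients have degree at most `2 * height f₁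
g₁ + 2`. -/
theorem exists_next [CharP F 2] {b : F} {f₀ g₀ f₁ g₁ : F[X]}
    (h₀ : IsCoprime f₀ g₀) (h₁ : IsCoprime f₁ g₁) (hΦ : biquadratic b f₀ g₀ f₁ g₁ = 0) :
    ∃ f₂ g₂, IsCoprime f₂ g₂ ∧ biquadratic b f₁ g₁ f₂ g₂ = 0 ∧
      height f₀ g₀ + height f₂ g₂ ≤ 2 * height f₁ g₁ + 2 := by
  have h2 : (2 : F[X]) = 0 := by exact_mod_cast CharP.cast_eq_zero F[X] 2
  obtain ⟨A, hA⟩ : ∃ A, A = (f₁ + X * g₁) ^ 2 := ⟨_, rfl⟩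
  obtain ⟨B, hB⟩ : ∃ B, B = X * f₁ * g₁ := ⟨_, rfl⟩
  obtain ⟨D, hD⟩ : ∃ D, D = X ^ 2 * f₁ ^ 2 + C b * g₁ ^ 2 := ⟨_, rfl⟩
  have hroot : A * f₀ ^ 2 + B * f₀ * g₀ + D * g₀ ^ 2 = 0 := by
    rw [← hΦ, hA, hB, hD]
    unfold biquadratic
    linear_combination (X * f₁ * g₁ * f₀ ^ 2) * h2
  have hne₀ : ¬(f₀ = 0 ∧ g₀ = 0) := by
    rintro ⟨rfl, rfl⟩
    exact not_isCoprime_zero_zero h₀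
  obtain ⟨g₂, hg₂⟩ : g₀ ∣ A := by
    refine (h₀.symm.pow_right (n := 2)).dvd_of_dvd_mul_right ⟨-(B * f₀ + D * g₀), ?_⟩
    linear_combination hroot
  obtain ⟨f₂, hf₂⟩ : f₀ ∣ D := by
    refine (h₀.pow_right (n := 2)).dvd_of_dvd_mul_right ⟨-(A * f₀ + B * g₀), ?_⟩
    linear_combination hroot
  have key : ∃ f₂ g₂, A = g₀ * g₂ ∧ D = f₀ * f₂ ∧ B = f₀ * g₂ + f₂ * g₀ := by
    -- When `f₀` or `g₀` vanishes, coprimality makes the other a unit, so the missing cofactor is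
    -- `B` divided by it.
    by_cases hf : f₀ = 0
    · subst hf
      obtain ⟨u, hu⟩ := isCoprime_zero_left.mp h₀
      refine ⟨B * ↑u⁻¹, g₂, hg₂, by rw [hf₂]; ring, ?_⟩
      rw [← hu, mul_assoc]; simp
    by_cases hg : g₀ = 0
    · subst hg
      obtain ⟨u, hu⟩ := isCoprime_zero_right.mp h₀
      refine ⟨f₂, B * ↑u⁻¹, by rw [hg₂]; ring, hf₂, ?_⟩
      rw [← hu, mul_left_comm]; simp
    refine ⟨f₂, g₂, hg₂, hf₂, ?_⟩
    apply mul_left_cancel₀ (mul_ne_zero hf hg)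
    rw [hg₂, hf₂] at hroot
    linear_combination hroot - (f₀ ^ 2 * g₀ * g₂ + f₀ * g₀ ^ 2 * f₂) * h2
  obtain ⟨f₂, g₂, eA, eD, eB⟩ := key
  have hne₂ : ¬(f₂ = 0 ∧ g₂ = 0) := by
    rintro ⟨rfl, rfl⟩
    have hA0 : f₁ + X * g₁ = 0 := by
      have : (f₁ + X * g₁) ^ 2 = 0 := by rw [← hA, eA, mul_zero]
      exact pow_eq_zero_iff two_ne_zero |>.mp this
    have hB0 : X * f₁ * g₁ = 0 := by rw [← hB, eB]; simp
    have : f₁ = 0 ∧ g₁ = 0 := by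
      rcases mul_eq_zero.mp hB0 with h | h
      · have hf : f₁ = 0 := (mul_eq_zero.mp h).resolve_left X_ne_zero
        rw [hf, zero_add] at hA0
        exact ⟨hf, (mul_eq_zero.mp hA0).resolve_left X_ne_zero⟩
      · rw [h] at hA0
        exact ⟨by simpa using hA0, h⟩
    rw [this.1, this.2] at h₁
    exact not_isCoprime_zero_zero h₁
  have hf₁ : f₁.natDegree ≤ height f₁ g₁ := le_max_left _ _
  have hg₁ : g₁.natDegree ≤ height f₁ g₁ := le_max_right _ _
  have hle : height f₀ g₀ + height f₂ g₂ ≤ 2 * height f₁ g₁ + 2 := by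
    generalize height f₁ g₁ = H at *
    apply height_add_height_le hne₀ hne₂
    · rw [← eA, hA, natDegree_pow]
      have : (f₁ + X * g₁).natDegree ≤ H + 1 := by
        refine natDegree_add_le_of_degree_le (by omega) (natDegree_mul_le.trans ?_)
        rw [natDegree_X]; omega
      omega
    · rw [← eB, hB]
      refine natDegree_mul_le.trans ((add_le_add natDegree_mul_le le_rfl).trans ?_)
      rw [natDegree_X]; omega
    · rw [← eD, hD]
      refine natDegree_add_le_of_degree_le (natDegree_mul_le.trans ?_) (natDegree_mul_le.trans ?_)
      · rw [natDegree_X_pow, natDegree_pow]; omega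
      · rw [natDegree_C, natDegree_pow]; omega
  have hΦ₂ : biquadratic b f₁ g₁ f₂ g₂ = 0 := by
    have : biquadratic b f₁ g₁ f₂ g₂ = A * f₂ ^ 2 + B * f₂ * g₂ + D * g₂ ^ 2 := by
      rw [hA, hB, hD]
      unfold biquadratic
      linear_combination -(X * f₁ * g₁ * f₂ ^ 2) * h2
    rw [this, eA, eB, eD]
    linear_combination (g₀ * g₂ * f₂ ^ 2 + f₀ * g₂ ^ 2 * f₂) * h2
  obtain ⟨f', g', hc, hz, hh⟩ := exists_isCoprime_of_biquadratic_eq_zero hne₂ hΦ₂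
  exact ⟨f', g', hc, hz, by omega⟩

/-- Iterating `exists_next` gives heights with second differences at most `2`; an initial step of at
most `c + 1` keeps the `n`-th height below the displayed quadratic. -/
theorem quadratic_nonneg_of_height_le [CharP F 2] {b : F} {f₀ g₀ f₁ g₁ : F[X]} {c : ℤ}
    (h₀ : IsCoprime f₀ g₀) (h₁ : ¬(f₁ = 0 ∧ g₁ = 0)) (hΦ : biquadratic b f₀ g₀ f₁ g₁ = 0)
    (hc : (height f₁ g₁ : ℤ) ≤ height f₀ g₀ + c + 1) (n : ℕ) :
    0 ≤ (n : ℤ) ^ 2 + n * c + height f₀ g₀ := by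
  have key : ∀ n : ℕ, ∃ f g f' g' : F[X], IsCoprime f g ∧ IsCoprime f' g' ∧
      biquadratic b f g f' g' = 0 ∧ (height f' g' : ℤ) - height f g ≤ c + 2 * n + 1 ∧
      (height f g : ℤ) ≤ (n : ℤ) ^ 2 + n * c + height f₀ g₀ := by
    intro n
    induction n with
    | zero =>
      obtain ⟨f', g', hc', hz, hh⟩ := exists_isCoprime_of_biquadratic_eq_zero h₁ hΦ
      refine ⟨f₀, g₀, f', g', h₀, hc', hz, ?_, by simp⟩
      push_cast
      omega
    | succ n ih =>
      obtain ⟨f, g, f', g', h, h', hz, hd, hn⟩ := ih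
      obtain ⟨f₂, g₂, h₂, hz₂, hh⟩ := exists_next h h' hz
      refine ⟨f', g', f₂, g₂, h', h₂, hz₂, ?_, ?_⟩
      · push_cast; omega
      · push_cast; linarith
  obtain ⟨f, g, -, -, -, -, -, -, h⟩ := key n
  exact le_trans (Int.natCast_nonneg _) h

end Heights

section Units

variable {F : Type*} [Field F] [Fintype F] [DecidableEq F]

theorem sum_units_add {M : Type*} [AddCommMonoid M] (f : F → M) :
    ∑ x : Fˣ, f x + f 0 = ∑ x : F, f x := by
  rw [← Finset.sum_erase_add _ _ (Finset.mem_univ (0 : F))]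
  congr 1
  refine Finset.sum_bij (fun x _ => (x : F)) ?_ ?_ ?_ ?_
  · simp
  · intro a _ b _ h; exact Units.ext h
  · intro b hb
    exact ⟨Units.mk0 b (Finset.ne_of_mem_erase hb), Finset.mem_univ _, rfl⟩
  · simp

theorem card_units_int : (Fintype.card Fˣ : ℤ) = Fintype.card F - 1 := by
  rw [Fintype.card_units, Nat.cast_sub Fintype.card_pos]; simp

end Units

/-! ### Trace, additive character, and Kloosterman sums mod 4 -/

section Character

variable {F : Type*} [Field F] [Algebra (ZMod 2) F]

variable (F) in
theorem charP_two : CharP F 2 :=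
  charP_of_injective_algebraMap (algebraMap (ZMod 2) F).injective 2

theorem tr_add (x y : F) : tr (x + y) = tr x + tr y := map_add _ x y

@[simp]
theorem tr_zero : tr (0 : F) = 0 := map_zero _

@[simp]
theorem lam_zero : lam (0 : F) = 1 := by simp [lam]

theorem lam_add (x y : F) : lam (x + y) = lam x * lam y := by
  unfold lam
  rw [tr_add]
  generalize tr x = u
  generalize tr y = v
  decide +revert

theorem lam_eq_ite (x : F) : lam x = if tr x = 0 then 1 else -1 := by
  unfold lam
  generalize tr x = u
  decide +revert

theorem lam_sum {ι : Type*} (s : Finset ι) (f : ι → F) :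
    lam (∑ i ∈ s, f i) = ∏ i ∈ s, lam (f i) := by
  classical
  induction s using Finset.induction_on with
  | empty => simp
  | insert a s ha ih => rw [Finset.sum_insert ha, Finset.prod_insert ha, lam_add, ih]

variable [Fintype F]

theorem algebraMap_tr {r : ℕ} (hF : Fintype.card F = 2 ^ r) (x : F) :
    algebraMap (ZMod 2) F (tr x) = ∑ i ∈ Finset.range r, x ^ 2 ^ i := by
  have hr : Module.finrank (ZMod 2) F = r := by
    have := Module.card_eq_pow_finrank (K := ZMod 2) (V := F)
    rw [hF, ZMod.card] at this
    exact (Nat.pow_right_injective le_rfl this).symm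
  rw [tr, FiniteField.algebraMap_trace_eq_sum_pow, hr, Nat.card_zmod]

theorem tr_sq (x : F) : tr (x ^ 2) = tr x := by
  have h := charP_two F
  have hF := Module.card_eq_pow_finrank (K := ZMod 2) (V := F)
  rw [ZMod.card] at hF
  apply (algebraMap (ZMod 2) F).injective
  rw [algebraMap_tr hF, algebraMap_tr hF]
  simp_rw [← pow_mul, ← pow_succ']
  have h₁ := Finset.sum_range_succ (fun i => x ^ 2 ^ i) (Module.finrank (ZMod 2) F)
  rw [Finset.sum_range_succ', ← hF, FiniteField.pow_card] at h₁
  simpa using h₁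

theorem lam_sq (x : F) : lam (x ^ 2) = lam x := by rw [lam, lam, tr_sq]

theorem exists_lam_mul_eq_neg_one {a : F} (ha : a ≠ 0) : ∃ x, lam (a * x) = -1 := by
  have htr := (traceForm_nondegenerate (ZMod 2) F).1 a
  simp_rw [Algebra.traceForm_apply] at htr
  by_contra! hf
  refine ha (htr fun x => ?_)
  have := hf x
  rw [lam_eq_ite] at this
  by_contra h
  exact this (if_neg h)

variable [DecidableEq F]

theorem sum_lam_mul (a : F) :
    ∑ x : F, lam (a * x) = if a = 0 then (Fintype.card F : ℤ) else 0 := by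
  split_ifs with ha
  · simp [ha]
  · obtain ⟨y, hy⟩ := exists_lam_mul_eq_neg_one ha
    have h : ∑ x : F, lam (a * x) = ∑ x : F, lam (a * (x + y)) :=
      (Fintype.sum_equiv (Equiv.addRight y) _ _ fun x => rfl).symm
    simp_rw [mul_add, lam_add, hy, mul_neg_one, Finset.sum_neg_distrib] at h
    omega

theorem sum_units_lam_mul (a : F) :
    ∑ x : Fˣ, lam (a * (x : F)) = (if a = 0 then (Fintype.card F : ℤ) else 0) - 1 := by
  have := sum_units_add fun x : F => lam (a * x)
  rw [sum_lam_mul, mul_zero, lam_zero] at this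
  omega

theorem sum_units_lam : ∑ x : Fˣ, lam (x : F) = -1 := by
  simpa using sum_units_lam_mul (1 : F)

theorem K_one (a : Fˣ) : K 1 a = ∑ x : Fˣ, lam ((x : F) + (a : F) * (x : F)⁻¹) := by
  unfold K
  exact Fintype.sum_equiv (Equiv.funUnique (Fin 1) Fˣ) _ _ fun x => by simp

/-- The arguments `x` at which `λ(x + a x⁻¹) = 1`. -/
noncomputable def kloostermanZeros (a : Fˣ) : Finset Fˣ :=
  Finset.univ.filter fun x => tr ((x : F) + (a : F) * (x : F)⁻¹) = 0

theorem K_one_eq_card (a : Fˣ) :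
    K 1 a = 2 * ((kloostermanZeros a).card : ℤ) - (Fintype.card F - 1) := by
  rw [K_one, ← card_units_int, kloostermanZeros, Finset.card_filter]
  simp_rw [lam_eq_ite]
  push_cast
  rw [Finset.mul_sum, ← Finset.card_univ, Finset.card_eq_sum_ones]
  push_cast
  rw [← Finset.sum_sub_distrib]
  refine Finset.sum_congr rfl fun x _ => ?_
  split_ifs <;> simp

/-- The involution `x ↦ a x⁻¹` fixes only the square root of `a`. -/
theorem odd_card_kloostermanZeros (a : Fˣ) : Odd (kloostermanZeros a).card := by
  have h2 := charP_two F
  obtain ⟨s, hs⟩ : ∃ s : F, s ^ 2 = a := by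
    obtain ⟨s, hs⟩ := FiniteField.isSquare_of_char_two (ringChar.eq F 2) (a : F)
    exact ⟨s, by rw [hs, sq]⟩
  have hs0 : s ≠ 0 := by rintro rfl; exact a.ne_zero (by rw [← hs]; simp)
  have hmem : Units.mk0 s hs0 ∈ kloostermanZeros a := by
    simp only [kloostermanZeros, Finset.mem_filter, Finset.mem_univ, true_and, Units.val_mk0]
    rw [← hs, sq, mul_assoc, mul_inv_cancel₀ hs0, mul_one, CharTwo.add_self_eq_zero, tr_zero]
  rw [← Finset.card_erase_add_one hmem]
  refine Even.add_one ?_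
  have := Finset.sum_involution (s := (kloostermanZeros a).erase (Units.mk0 s hs0))
    (f := fun _ => (1 : ZMod 2)) (fun x _ => a * x⁻¹) (fun _ _ => by decide) ?_ ?_ ?_
  · simpa [ZMod.natCast_eq_zero_iff_even] using this
  · intro x hx _ heq
    apply (Finset.mem_erase.mp hx).1
    have h1 : a = x * x := by rw [mul_inv_eq_iff_eq_mul] at heq; exact heq
    have h3 : (x : F) ^ 2 = s ^ 2 := by rw [hs, h1]; simp [sq]
    exact Units.ext (CharTwo.sq_injective h3)
  · intro x hx
    simp only [kloostermanZeros, Finset.mem_erase, Finset.mem_filter, Finset.mem_univ, true_and]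
      at hx ⊢
    refine ⟨fun heq => hx.1 ?_, ?_⟩
    · rw [mul_inv_eq_iff_eq_mul] at heq
      have h1 : s * s = s * x := by
        have := congrArg (fun u : Fˣ => (u : F)) heq
        simp only [Units.val_mul, Units.val_mk0, ← hs, sq] at this
        exact this
      exact Units.ext (mul_left_cancel₀ hs0 h1).symm
    · have : ((a * x⁻¹ : Fˣ) : F) + a * ((a * x⁻¹ : Fˣ) : F)⁻¹ = x + a * (x : F)⁻¹ := by
        push_cast
        field_simp
        ring
      rw [this]; exact hx.2
  · intro x _; simp

/-- Twice an odd number is `2` mod 4, and `4 ∣ q` makes `-(q - 1)` equal to `1` mod 4. -/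
theorem K_one_modEq {r : ℕ} (hr : 2 ≤ r) (hF : Fintype.card F = 2 ^ r) (a : Fˣ) :
    K 1 a ≡ -1 [ZMOD 4] := by
  obtain ⟨m, hm⟩ := odd_card_kloostermanZeros a
  obtain ⟨k, rfl⟩ := Nat.exists_eq_add_of_le hr
  rw [K_one_eq_card, hm, hF]
  refine (Int.modEq_iff_dvd.mpr ⟨2 ^ k - m - 1, ?_⟩)
  push_cast
  ring

end Character

/-! ### Cancellation in the first step of the progression -/

section Weil

open Polynomial

variable {F : Type*} [Field F] [Fintype F]

/-- The fraction `N / (X ^ q + X) ^ 2` neighbours `X ^ q`. Numerator and denominator share `X` and a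
double factor at each point of `Z`, so the height falls from `2 * q + 1` to at most `2 * q - 2 *
Z.card`; this fixes `c`. -/
theorem quadratic_nonneg_of_roots [CharP F 2] {q : ℕ} (hF : Fintype.card F = q) {b : F} {N : F[X]}
    (hN : N ^ 2 + X ^ (q + 1) * N = (X ^ q + X) ^ 2 * (X ^ (2 * q + 2) + C b))
    (hX : X ∣ N) (hdeg : N.natDegree ≤ 2 * q + 1) (Z : Finset F)
    (hZ : ∀ c ∈ Z, c ≠ 0 ∧ N.eval c = 0) (n : ℕ) :
    0 ≤ (n : ℤ) ^ 2 + n * (q - 1 - 2 * Z.card) + q := by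
  have h2 : (2 : F[X]) = 0 := by exact_mod_cast CharP.cast_eq_zero F[X] 2
  have hq : 1 < q := hF ▸ Fintype.one_lt_card
  have hSdeg : (X ^ q + X : F[X]).natDegree = q := by
    rw [natDegree_add_eq_left_of_natDegree_lt] <;> simp [hq]
  have hS0 : (X ^ q + X : F[X]) ≠ 0 := by
    intro h; rw [h] at hSdeg; simp at hSdeg; omega
  set H : F[X] := ∏ c ∈ Z, (X - C c) ^ 2 with hH
  have hHmonic : H.Monic := monic_prod_of_monic _ _ fun c _ => (monic_X_sub_C c).pow 2
  have hHdeg : H.natDegree = 2 * Z.card := by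
    rw [hH, natDegree_prod_of_monic _ _ fun c _ => (monic_X_sub_C c).pow 2]
    simp [mul_comm]
  have hXH : IsCoprime (X : F[X]) H := by
    refine IsCoprime.prod_right fun c hc => IsCoprime.pow_right ?_
    simpa using isCoprime_X_sub_C_of_isUnit_sub (a := (0 : F)) (b := c)
      (by simpa using (hZ c hc).1)
  have hdvd {P : F[X]} (hP0 : X ∣ P) (hP : ∀ c ∈ Z, (X - C c) ^ 2 ∣ P) : X * H ∣ P := by
    refine hXH.mul_dvd hP0 (Finset.prod_dvd_of_coprime ?_ hP)
    intro c _ d _ hcd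
    exact (pairwise_coprime_X_sub_C Function.injective_id hcd).pow
  have hSc (c : F) : (X - C c) ^ 2 ∣ (X ^ q + X : F[X]) ^ 2 := by
    refine pow_dvd_pow_of_dvd (dvd_iff_isRoot.mpr ?_) 2
    have hc : c ^ q = c := hF ▸ FiniteField.pow_card c
    simp [hc, CharTwo.add_self_eq_zero]
  obtain ⟨A', hA'⟩ : X * H ∣ (X ^ q + X : F[X]) ^ 2 := by
    refine hdvd (dvd_pow (dvd_add (dvd_pow_self X (by omega)) dvd_rfl) two_ne_zero) fun c _ => hSc c
  obtain ⟨N', hN'⟩ : X * H ∣ N := by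
    refine hdvd hX fun c hc => ?_
    -- At `c` the conjugate root `N + X ^ (q + 1)` takes the value `c ^ (q + 1) ≠ 0`, so the double
    -- zero of the product `N * (N + X ^ (q + 1))` belongs entirely to `N`.
    have hcop : IsCoprime ((X - C c) ^ 2) (N + X ^ (q + 1)) := by
      refine IsCoprime.pow_left ?_
      rw [(irreducible_X_sub_C c).coprime_iff_not_dvd, dvd_iff_isRoot]
      simp [(hZ c hc).2, (hZ c hc).1]
    refine hcop.dvd_of_dvd_mul_right ?_
    have : N * (N + X ^ (q + 1)) = (X ^ q + X) ^ 2 * (X ^ (2 * q + 2) + C b) := by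
      rw [← hN]; ring
    rw [this]
    exact (hSc c).mul_right _
  have hG0 : X * H ≠ 0 := mul_ne_zero X_ne_zero hHmonic.ne_zero
  have hGdeg : (X * H).natDegree = 2 * Z.card + 1 := by
    rw [natDegree_mul X_ne_zero hHmonic.ne_zero, hHdeg, natDegree_X]; ring
  have hA0 : A' ≠ 0 := by
    rintro rfl
    rw [mul_zero] at hA'
    exact pow_ne_zero 2 hS0 hA'
  have hAdeg : 2 * q = 2 * Z.card + 1 + A'.natDegree := by
    have := congrArg natDegree hA'
    rwa [natDegree_pow, hSdeg, natDegree_mul hG0 hA0, hGdeg] at this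
  have hNdeg : N'.natDegree ≤ 2 * q - 2 * Z.card := by
    rcases eq_or_ne N' 0 with rfl | h
    · simp
    · rw [hN', natDegree_mul hG0 h, hGdeg] at hdeg
      omega
  have hΦ : biquadratic b (X ^ q) 1 N' A' = 0 := by
    have : (X * H) ^ 2 * biquadratic b (X ^ q) 1 N' A' = 0 := by
      have e : (X * H) ^ 2 * biquadratic b (X ^ q) 1 N' A' =
          biquadratic b (X ^ q) 1 (X * H * N') (X * H * A') := by
        unfold biquadratic; ring
      rw [e, ← hN', ← hA']
      unfold biquadratic
      linear_combination (X ^ q + X) ^ 2 * hN +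
        ((X ^ q + X) ^ 4 * (X ^ (2 * q + 2) + C b) - X ^ (q + 1) * N ^ 2) * h2
    exact (mul_eq_zero.mp this).resolve_left (pow_ne_zero 2 hG0)
  have hht : height (X ^ q : F[X]) 1 = q := by simp [height]
  have := quadratic_nonneg_of_height_le (c := q - 1 - 2 * Z.card) isCoprime_one_right
    (fun h => hA0 h.2) hΦ ?_ n
  · rwa [hht] at this
  · rw [hht]
    have : height N' A' ≤ 2 * q - 2 * Z.card := max_le hNdeg (by omega)
    omega

end Weil

/-! ### The Weil bound for `K 1` -/

section WeilBound

open Polynomial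

variable {F : Type*} [Field F] [Fintype F] [Algebra (ZMod 2) F]

/-- The numerator of the `x`-coordinate of the sum of `(X, 0)` and the image of `(X, 0)` under
Frobenius, on the curve `y² + x y = x³ + (X + a² / X²) x² + a²`. -/
theorem exists_numerator {r : ℕ} (hF : Fintype.card F = 2 ^ r) (a : F) :
    ∃ N : F[X], N ^ 2 + X ^ (2 ^ r + 1) * N =
        (X ^ 2 ^ r + X) ^ 2 * (X ^ (2 * 2 ^ r + 2) + C (a ^ 2)) ∧
      X ∣ N ∧ N.natDegree ≤ 2 * 2 ^ r + 1 ∧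
      ∀ c : F, c ≠ 0 → N.eval c = c ^ 2 * algebraMap (ZMod 2) F (tr (c + a * c⁻¹)) := by
  have := charP_two F
  have h2 : (2 : F[X]) = 0 := by exact_mod_cast CharP.cast_eq_zero F[X] 2
  set T : F[X] := X ^ 2 ^ r with hT
  -- `S + R / T` is the trace polynomial of `X + a² / X²`. The `f i` are the summands of `T * R`,
  -- and the `f (i + 1)` those of `R ^ 2`, so `R ^ 2 + T * R` telescopes.
  set S : F[X] := ∑ i ∈ Finset.range r, X ^ 2 ^ i with hS
  set f : ℕ → F[X] := fun i => C ((a ^ 2) ^ 2 ^ i) * X ^ (2 * 2 ^ r - 2 ^ (i + 1)) with hf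
  set R : F[X] := ∑ i ∈ Finset.range r, C ((a ^ 2) ^ 2 ^ i) * X ^ (2 ^ r - 2 ^ (i + 1)) with hR
  have hpow {i : ℕ} (hi : i < r) : 2 ^ (i + 1) ≤ 2 ^ r := Nat.pow_le_pow_right two_pos hi
  have hS2 : S ^ 2 + S = T + X := by
    have e : S ^ 2 = ∑ i ∈ Finset.range r, X ^ 2 ^ (i + 1) := by
      rw [hS, CharTwo.sum_sq]
      exact Finset.sum_congr rfl fun i _ => by rw [← pow_mul, ← pow_succ]
    have h₁ := Finset.sum_range_succ (fun i => (X : F[X]) ^ 2 ^ i) r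
    rw [Finset.sum_range_succ', ← e, ← hS, pow_zero, pow_one] at h₁
    linear_combination h₁ + (S - X) * h2
  have hR2 : R ^ 2 + T * R = C (a ^ 2) * X ^ (2 * 2 ^ r - 2) + C (a ^ 2) := by
    have e₁ : R ^ 2 = ∑ i ∈ Finset.range r, f (i + 1) := by
      rw [hR, CharTwo.sum_sq]
      refine Finset.sum_congr rfl fun i hi => ?_
      simp only [hf]
      rw [mul_pow, ← C_pow, ← pow_mul (a ^ 2), ← pow_mul X, ← pow_succ, Nat.sub_mul, mul_comm _ 2,
        pow_succ 2 (i + 1)]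
    have e₂ : T * R = ∑ i ∈ Finset.range r, f i := by
      rw [hR, Finset.mul_sum]
      refine Finset.sum_congr rfl fun i hi => ?_
      have := hpow (Finset.mem_range.mp hi)
      simp only [hf, hT]
      rw [mul_left_comm, ← pow_add]
      congr 2
      omega
    have h₁ := Finset.sum_range_succ f r
    rw [Finset.sum_range_succ', ← e₁, ← e₂] at h₁
    have h0 : f 0 = C (a ^ 2) * X ^ (2 * 2 ^ r - 2) := by simp [hf]
    have hr : f r = C (a ^ 2) := by
      have : (a ^ 2) ^ 2 ^ r = a ^ 2 := hF ▸ FiniteField.pow_card _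
      simp only [hf]
      rw [this, pow_succ 2 r, mul_comm 2, Nat.sub_self, pow_zero, mul_one]
    rw [h0, hr] at h₁
    linear_combination h₁ + (T * R - C (a ^ 2) * X ^ (2 * 2 ^ r - 2)) * h2
  have hXT : X ^ 2 * (X : F[X]) ^ (2 * 2 ^ r - 2) = T ^ 2 := by
    have : 1 ≤ 2 ^ r := Nat.one_le_two_pow
    rw [hT, ← pow_add, ← pow_mul]
    congr 1
    omega
  -- The Frobenius image is `(T, T * S + R)`; the chord through it and `(X, 0)` has slope `(T * S +
  -- R) / (T + X)`, and the addition formula gives this numerator over `(T + X) ^ 2`.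
  refine ⟨X * (T * S + R + T * (T + X)), ?_, dvd_mul_right _ _, ?_, ?_⟩
  · have e₁ : (X : F[X]) ^ (2 ^ r + 1) = T * X := pow_succ _ _
    have e₂ : (X : F[X]) ^ (2 * 2 ^ r + 2) = T ^ 2 * X ^ 2 := by
      rw [hT, ← pow_mul, ← pow_add]; ring_nf
    rw [e₁, e₂]
    linear_combination X ^ 2 * T ^ 2 * hS2 + X ^ 2 * hR2 + C (a ^ 2) * hXT +
      X ^ 2 * (T * S * R + (T * S + R) * T * (T + X) + T ^ 3 + T ^ 2 * X) * h2 +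
      (- X * C (a ^ 2) * T) * h2
  · refine natDegree_mul_le.trans ?_
    rw [natDegree_X, add_comm]
    refine Nat.add_le_add_right ?_ 1
    have hTd : T.natDegree = 2 ^ r := natDegree_X_pow _
    have hSd : S.natDegree ≤ 2 ^ r := natDegree_sum_le_of_forall_le _ _ fun i hi => by
      have := hpow (Finset.mem_range.mp hi)
      rw [natDegree_X_pow]
      omega
    have hRd : R.natDegree ≤ 2 * 2 ^ r := natDegree_sum_le_of_forall_le _ _ fun i hi =>
      (natDegree_C_mul_X_pow_le _ _).trans ((Nat.sub_le _ _).trans (by omega))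
    refine natDegree_add_le_of_degree_le (natDegree_add_le_of_degree_le ?_ hRd) ?_
    · exact natDegree_mul_le.trans (by omega)
    · refine natDegree_mul_le.trans ?_
      have : (T + X).natDegree ≤ 2 ^ r :=
        natDegree_add_le_of_degree_le hTd.le (natDegree_X.trans_le Nat.one_le_two_pow)
      omega
  · intro c hc
    have hcq : c ^ 2 ^ r = c := hF ▸ FiniteField.pow_card c
    have htr : tr (c + a * c⁻¹) = tr (c + a ^ 2 * (c⁻¹) ^ 2) := by
      rw [tr_add, tr_add, ← mul_pow, tr_sq]
    rw [htr, algebraMap_tr hF]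
    have hsum : ∑ i ∈ Finset.range r, (c + a ^ 2 * (c⁻¹) ^ 2) ^ 2 ^ i =
        S.eval c + c⁻¹ * R.eval c := by
      simp only [hS, hR, eval_finsetSum, Finset.mul_sum, ← Finset.sum_add_distrib]
      refine Finset.sum_congr rfl fun i hi => ?_
      rw [add_pow_char_pow, mul_pow]
      simp only [eval_pow, eval_X, eval_mul, eval_C]
      congr 1
      have := hpow (Finset.mem_range.mp hi)
      have e : c ^ (2 ^ r - 2 ^ (i + 1)) * c ^ (2 ^ (i + 1)) = c := by
        rw [← pow_add, Nat.sub_add_cancel this, hcq]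
      rw [← pow_mul c⁻¹, ← pow_succ', inv_pow, mul_left_comm]
      congr 1
      rw [inv_eq_iff_eq_inv, mul_inv, inv_inv]
      rw [eq_mul_inv_iff_mul_eq₀ (pow_ne_zero _ hc), mul_comm, e]
    rw [hsum]
    simp only [eval_mul, eval_add, eval_X, hT, eval_pow, hcq, CharTwo.add_self_eq_zero]
    field_simp
    ring

variable [DecidableEq F]

theorem K_one_quadratic_nonneg {r : ℕ} (hF : Fintype.card F = 2 ^ r) (a : Fˣ) (n : ℤ) :
    0 ≤ n ^ 2 - n * K 1 a + 2 ^ r := by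
  have := charP_two F
  obtain ⟨N, hN, hX, hdeg, hev⟩ := exists_numerator hF (a : F)
  have hinj : Function.Injective fun x : Fˣ => (x : F) := fun _ _ h => Units.ext h
  have hcard (s : Finset Fˣ) : (s.image fun x : Fˣ => (x : F)).card = s.card :=
    Finset.card_image_of_injective _ hinj
  have hK := K_one_eq_card a
  rw [hF] at hK
  push_cast at hK
  rcases Int.eq_nat_or_neg n with ⟨m, rfl | rfl⟩
  · have := quadratic_nonneg_of_roots hF hN hX hdeg
      ((kloostermanZeros a).image fun x : Fˣ => (x : F)) ?_ m
    · rw [hcard] at this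
      push_cast at this
      rw [hK]
      linarith
    · intro c hc
      obtain ⟨x, hx, rfl⟩ := Finset.mem_image.mp hc
      refine ⟨x.ne_zero, ?_⟩
      rw [hev _ x.ne_zero, (Finset.mem_filter.mp hx).2, map_zero, mul_zero]
  -- For negative `n` walk in the opposite direction: the conjugate root `N + X ^ (2 ^ r + 1)`
  -- vanishes where the trace is `1`, which exchanges `kloostermanZeros a` with its complement.
  · have h2 : (2 : F[X]) = 0 := by exact_mod_cast CharP.cast_eq_zero F[X] 2
    have := quadratic_nonneg_of_roots hF (N := N + X ^ (2 ^ r + 1)) (b := (a : F) ^ 2)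
      (by linear_combination hN + (X ^ (2 ^ r + 1) * N + (X ^ (2 ^ r + 1)) ^ 2) * h2)
      (dvd_add hX (dvd_pow_self X (by omega)))
      (natDegree_add_le_of_degree_le hdeg (by rw [natDegree_X_pow]; omega))
      ((kloostermanZeros a)ᶜ.image fun x : Fˣ => (x : F)) ?_ m
    · rw [hcard, Finset.card_compl, Nat.cast_sub (Finset.card_le_univ _), card_units_int, hF]
        at this
      push_cast at this
      rw [hK]
      linarith
    · intro c hc
      obtain ⟨x, hx, rfl⟩ := Finset.mem_image.mp hc
      refine ⟨x.ne_zero, ?_⟩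
      have hx1 : tr ((x : F) + (a : F) * (x : F)⁻¹) = 1 := by
        have : tr ((x : F) + (a : F) * (x : F)⁻¹) ≠ 0 := by
          simpa [kloostermanZeros] using hx
        generalize tr ((x : F) + (a : F) * (x : F)⁻¹) = u at this
        decide +revert
      have hxq : (x : F) ^ 2 ^ r = x := hF ▸ FiniteField.pow_card (x : F)
      rw [eval_add, hev _ x.ne_zero, hx1, map_one, eval_pow, eval_X, pow_succ _ (2 ^ r), hxq,
        mul_one, sq, CharTwo.add_self_eq_zero]

/-- The Weil bound for Kloosterman sums over a field with `2 ^ r > 2` elements. -/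
theorem abs_K_one_lt {r : ℕ} (hr : 2 ≤ r) (hF : Fintype.card F = 2 ^ r) (a : Fˣ) :
    |(K 1 a : ℝ)| < 2 * √((2 ^ r : ℕ) : ℝ) := by
  obtain ⟨k, hk⟩ := (K_one_modEq hr hF a).dvd
  obtain ⟨m, hm⟩ : ∃ m, K 1 a = 2 * m + 1 := ⟨-2 * k - 1, by linarith⟩
  -- Writing `K 1 a = 2 * m + 1`, the value at `n = m` is `2 ^ r - m * (m + 1)`, close to the
  -- minimum.
  have hn := K_one_quadratic_nonneg hF a m
  rw [hm] at hn
  -- The congruence mod 4 makes `m` odd, so as a divisor of `2 ^ r` it would be `±1`, giving a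
  -- product of `2` or `0`, less than `4`.
  have hne : m * (m + 1) ≠ 2 ^ r := by
    intro h
    have hm2 : m = -1 - 2 * k := by linarith
    have hdvd : m.natAbs ∣ 2 ^ r := by
      have : m ∣ ((2 ^ r : ℕ) : ℤ) := ⟨m + 1, by push_cast; exact h.symm⟩
      exact Int.natAbs_dvd_natAbs.mpr this
    obtain ⟨i, -, hi⟩ := (Nat.dvd_prime_pow Nat.prime_two).mp hdvd
    have hi0 : i = 0 := by
      by_contra h0
      have : 2 ∣ m.natAbs := hi ▸ dvd_pow_self 2 h0
      omega
    rw [hi0, pow_zero] at hi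
    have h4 : (4 : ℤ) ≤ 2 ^ r := by
      calc (4 : ℤ) = 2 ^ 2 := by norm_num
        _ ≤ 2 ^ r := pow_le_pow_right₀ (by norm_num) hr
    rcases Int.natAbs_eq m with h1 | h1 <;> rw [hi] at h1 <;> rw [h1] at h <;> norm_num at h <;>
      omega
  have hlt : K 1 a ^ 2 < 4 * 2 ^ r := by
    have : m * (m + 1) < 2 ^ r := lt_of_le_of_ne (by linarith) hne
    rw [hm]
    have h3 : (2 * m + 1) ^ 2 = 4 * (m * (m + 1)) + 1 := by ring
    omega
  rw [← Real.sqrt_sq_eq_abs, show (2 : ℝ) * √((2 ^ r : ℕ) : ℝ) = √(4 * 2 ^ r) by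
    rw [Real.sqrt_mul (by norm_num), show (4 : ℝ) = 2 ^ 2 by norm_num,
      Real.sqrt_sq (by norm_num)]; push_cast; rfl]
  exact Real.sqrt_lt_sqrt (sq_nonneg _) (by exact_mod_cast hlt)

theorem K_one_mem_valueRange {r : ℕ} (hr : 2 ≤ r) (hF : Fintype.card F = 2 ^ r) (a : Fˣ) :
    K 1 a ∈ valueRange (2 ^ r) :=
  (mem_valueRange _ _).mpr ⟨abs_K_one_lt hr hF a, K_one_modEq hr hF a⟩

end WeilBound

/-! ### Binomial and Stirling identities -/

section Binomials

theorem binom_natCast (n k : ℕ) : binom n k = n.choose k := by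
  simp [binom, Ring.choose_natCast]

theorem binom_sub_sub {N j t : ℕ} (hjN : j ≤ N) (hjt : j ≤ t) :
    binom ((N : ℤ) - j) ((N : ℤ) - t) = (N - j).choose (t - j) := by
  rcases le_or_gt t N with h | h
  · rw [← Nat.cast_sub hjN, ← Nat.cast_sub h, binom_natCast, ← Nat.choose_symm (by omega)]
    congr 2
    omega
  -- For `t > N` the lower index on the left is negative, and on the right it exceeds the upper one:
  -- both sides vanish.
  · rw [Nat.choose_eq_zero_of_lt (by omega), binom, if_neg (by omega), Nat.cast_zero]

theorem pow_eq_sum_stirlingSecond (x h : ℕ) :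
    x ^ h = ∑ t ∈ Finset.range (h + 1), t ! * Nat.stirlingSecond h t * x.choose t := by
  have key : x ^ h = ∑ t ∈ Finset.range (h + 1), Nat.stirlingSecond h t * x.descFactorial t := by
    induction h with
    | zero => simp
    | succ h ih =>
      have hstep (t d : ℕ) : Nat.stirlingSecond (h + 1) (t + 1) * d =
          Nat.stirlingSecond h (t + 1) * ((t + 1) * d) + Nat.stirlingSecond h t * d := by
        rw [Nat.stirlingSecond_succ_succ]; ring
      have hmul (t : ℕ) :
          x.descFactorial t * x = x.descFactorial (t + 1) + t * x.descFactorial t := by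
        rw [Nat.descFactorial_succ]
        rcases le_or_gt t x with htx | htx
        · rw [← add_mul, Nat.sub_add_cancel htx, mul_comm]
        · simp [Nat.descFactorial_eq_zero_iff_lt.mpr htx]
      rw [pow_succ, ih, Finset.sum_mul, Finset.sum_range_succ' _ (h + 1)]
      simp_rw [mul_assoc, hmul, mul_add, hstep, Finset.sum_add_distrib]
      rw [Nat.stirlingSecond_succ_zero, zero_mul, add_zero, add_comm]
      congr 1
      rw [Finset.sum_range_succ' (fun t => Nat.stirlingSecond h t * (t * x.descFactorial t)),
        Finset.sum_range_succ _ h, Nat.stirlingSecond_eq_zero_of_lt (Nat.lt_succ_self h)]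
      simp only [zero_mul, mul_zero, add_zero]
  rw [key]
  exact Finset.sum_congr rfl fun t _ => by rw [Nat.descFactorial_eq_factorial_mul_choose]; ring

/-- The binomial expansion of the shifted moment, solved for its top term `l = h`. -/
theorem sum_pow_eq_of_sum_sub_pow_eq {ι : Type*} [Fintype ι] (g : ι → ℤ) (M A : ℤ) (h : ℕ)
    (hA : ∑ a, (g a - M) ^ h = A) :
    ∑ a, g a ^ h = ∑ l ∈ Finset.range h,
      (-1) ^ (h + l + 1) * (h.choose l : ℤ) * M ^ (h - l) * ∑ a, g a ^ l + A := by
  rw [← hA]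
  simp_rw [sub_eq_add_neg, add_pow]
  rw [Finset.sum_comm, Finset.sum_range_succ, ← add_assoc, ← Finset.sum_add_distrib]
  simp only [Nat.sub_self, pow_zero, mul_one, Nat.choose_self, Nat.cast_one]
  refine Eq.symm (add_eq_right.mpr (Finset.sum_eq_zero fun l hl => ?_))
  have hl' := Finset.mem_range.mp hl
  rw [Finset.mul_sum, ← Finset.sum_add_distrib]
  refine Finset.sum_eq_zero fun a _ => ?_
  obtain ⟨d, rfl⟩ := Nat.exists_eq_add_of_lt hl'
  rw [show l + d + 1 - l = d + 1 by omega, neg_pow M,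
    show l + d + 1 + l + 1 = d + 2 * (l + 1) by ring, pow_add (-1 : ℤ) d, pow_mul]
  ring

end Binomials

/-! ### Power moments and weight distributions -/

section Codes

variable {F : Type*} [Field F] [Algebra (ZMod 2) F] {ι : Type*} [Fintype ι] [DecidableEq ι]
  [DecidableEq F]

theorem weightCount_eq_card (v : ι → F) (j : ℕ) :
    weightCount (binaryCode v) j =
      (((Finset.univ : Finset ι).powersetCard j).filter fun J => ∑ i ∈ J, v i = 0).card := by
  have hz (x : ZMod 2) : x ≠ 0 → x = 1 := by decide +revert
  rw [← Nat.card_eq_finsetCard, weightCount]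
  refine Nat.card_congr
    { toFun := fun u => ⟨Finset.univ.filter fun i => u.1 i ≠ 0, ?_⟩
      invFun := fun J => ⟨fun i => if i ∈ J.1 then 1 else 0, ?_⟩
      left_inv := ?_
      right_inv := ?_ }
  · obtain ⟨u, hu, hj⟩ := u
    rw [Finset.mem_filter, Finset.mem_powersetCard]
    refine ⟨⟨Finset.subset_univ _, Eq.trans (by unfold hammingNorm; congr) hj⟩, ?_⟩
    rw [Finset.sum_filter]
    refine Eq.trans ?_ (show ∑ i, algebraMap (ZMod 2) F (u i) * v i = 0 from hu)
    refine Finset.sum_congr rfl fun i _ => ?_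
    by_cases hi : u i = 0
    · simp [hi]
    · simp [hz _ hi]
  · obtain ⟨J, hJ⟩ := J
    obtain ⟨hJ, hs⟩ := Finset.mem_filter.mp hJ
    refine ⟨?_, ?_⟩
    · change ∑ i, algebraMap (ZMod 2) F (if i ∈ J then 1 else 0) * v i = 0
      simpa [apply_ite] using hs
    · refine Eq.trans ?_ (Finset.mem_powersetCard.mp hJ).2
      unfold hammingNorm
      congr 1
      ext i
      simp
  · rintro ⟨u, hu⟩
    ext i
    by_cases hi : u i = 0
    · simp [hi]
    · simp [hz _ hi]
  · rintro ⟨J, hJ⟩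
    ext i
    simp

theorem weightCount_eq_zero_of_lt (v : ι → F) {j : ℕ} (hj : Fintype.card ι < j) :
    weightCount (binaryCode v) j = 0 := by
  rw [weightCount_eq_card, Finset.powersetCard_eq_empty.mpr (by simpa using hj)]
  simp

/-- Expanding the product over `J ⊆ T`, the sum over `a` keeps only those `J` with `∑ i ∈ J, v i =
0`, the supports of codewords. A support of size `j` lies in `(N - j).choose (t - j)` sets `T`,
where `N` is the length. -/
theorem sum_prod_sub_one {q : ℕ} [Fintype F] (hF : Fintype.card F = q) (v : ι → F) (t : ℕ) :
    ∑ a : F, ∑ T ∈ (Finset.univ : Finset ι).powersetCard t, ∏ i ∈ T, (lam (a * v i) - 1) =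
      q * ∑ j ∈ Finset.range (t + 1), (-1) ^ (t + j) * (weightCount (binaryCode v) j : ℤ) *
        ((Fintype.card ι - j).choose (t - j) : ℤ) := by
  have hT (a : F) (T : Finset ι) (h : T.card = t) : ∏ i ∈ T, (lam (a * v i) - 1) =
      ∑ J ∈ T.powerset, (-1) ^ (t + J.card) * lam ((∑ i ∈ J, v i) * a) := by
    simp_rw [sub_eq_add_neg, Finset.prod_add]
    refine Finset.sum_congr rfl fun J hJ => ?_
    have hJ' := Finset.mem_powerset.mp hJ
    rw [Finset.prod_const, Finset.card_sdiff_of_subset hJ', h, Finset.sum_mul, lam_sum, mul_comm]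
    congr 1
    · obtain ⟨d, hd⟩ := Nat.exists_eq_add_of_le (h ▸ Finset.card_le_card hJ')
      rw [hd, show J.card + d + J.card = d + 2 * J.card by ring, pow_add, pow_mul]
      simp
    · exact Finset.prod_congr rfl fun i _ => by rw [mul_comm]
  calc
    _ = ∑ T ∈ (Finset.univ : Finset ι).powersetCard t, ∑ J ∈ T.powerset,
          (-1) ^ (t + J.card) * (if ∑ i ∈ J, v i = 0 then (q : ℤ) else 0) := by
      rw [Finset.sum_comm]
      refine Finset.sum_congr rfl fun T h => ?_
      rw [Finset.sum_congr rfl fun a _ => hT a T (Finset.mem_powersetCard.mp h).2, Finset.sum_comm]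
      refine Finset.sum_congr rfl fun J _ => ?_
      rw [← Finset.mul_sum, sum_lam_mul, hF]
    _ = ∑ J : Finset ι, (((Finset.univ : Finset ι).powersetCard t).filter fun T => J ⊆ T).card *
          ((-1) ^ (t + J.card) * (if ∑ i ∈ J, v i = 0 then (q : ℤ) else 0)) := by
      rw [Finset.sum_comm' (t' := Finset.univ)
        (s' := fun J => ((Finset.univ : Finset ι).powersetCard t).filter fun T => J ⊆ T)]
      · simp
      · simp
    _ = ∑ j ∈ Finset.range (t + 1), ∑ J ∈ (Finset.univ : Finset ι).powersetCard j,
          ((Fintype.card ι - j).choose (t - j) : ℤ) *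
            ((-1) ^ (t + j) * (if ∑ i ∈ J, v i = 0 then (q : ℤ) else 0)) := by
      rw [← Finset.sum_subset (Finset.subset_univ
        (Finset.univ.filter fun J : Finset ι => J.card ∈ Finset.range (t + 1)))]
      · rw [← Finset.sum_fiberwise_of_maps_to (g := Finset.card) (t := Finset.range (t + 1))
          (by simp)]
        refine Finset.sum_congr rfl fun j hj => ?_
        refine Finset.sum_congr ?_ ?_
        · ext J
          simp only [Finset.mem_filter, Finset.mem_powersetCard, Finset.subset_univ, true_and,
            Finset.mem_univ]
          exact ⟨fun h => h.2, fun h => ⟨h ▸ hj, h⟩⟩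
        · intro J hJ
          have := (Finset.mem_powersetCard.mp hJ).2
          have hjt := Finset.mem_range.mp hj
          rw [Finset.card_filter_powersetCard_subset J _ t (Finset.subset_univ J) (by omega), this,
            Finset.card_univ]
      · intro J _ hJ
        rw [Finset.filter_eq_empty_iff.mpr, Finset.card_empty, Nat.cast_zero, zero_mul]
        intro T hT hJT
        have := Finset.card_le_card hJT
        have := (Finset.mem_powersetCard.mp hT).2
        simp at hJ
        omega
    _ = _ := by
      rw [Finset.mul_sum]
      refine Finset.sum_congr rfl fun j _ => ?_
      rw [← Finset.mul_sum, ← Finset.mul_sum, ← Finset.sum_filter, Finset.sum_const,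
        ← weightCount_eq_card, nsmul_eq_mul]
      ring

/-- The power moment identity for the family of vectors `(tr (a v_i))_i`, `a ∈ F`. -/
theorem sum_charSum_sub_card_pow [Fintype F] {q N : ℕ} (hF : Fintype.card F = q)
    (hN : Fintype.card ι = N) (v : ι → F) (h : ℕ) :
    ∑ a : F, (∑ i, lam (a * v i) - N) ^ h =
      q * ∑ j ∈ Finset.range (min N h + 1),
        (-1) ^ (h + j) * (weightCount (binaryCode v) j : ℤ) *
          ∑ t ∈ Finset.Icc j h, (t ! : ℤ) * (Nat.stirlingSecond h t : ℤ) * 2 ^ (h - t) *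
            binom ((N : ℤ) - j) ((N : ℤ) - t) := by
  -- Each factor is `0` or `-2`, so only the `T` inside the support of `(tr (a * v i))_i` survive.
  have hprod (a : F) (t : ℕ) : ∑ T ∈ (Finset.univ : Finset ι).powersetCard t,
      ∏ i ∈ T, (lam (a * v i) - 1) =
        (-2) ^ t * ((Finset.univ.filter fun i => tr (a * v i) ≠ 0).card.choose t : ℤ) := by
    rw [← Finset.card_powersetCard, ← Finset.sum_subset
      (Finset.powersetCard_mono (Finset.subset_univ
        (Finset.univ.filter fun i => tr (a * v i) ≠ 0)))]
    · rw [Finset.sum_congr rfl (g := fun _ => (-2 : ℤ) ^ t), Finset.sum_const, nsmul_eq_mul,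
        mul_comm]
      intro T hT
      obtain ⟨h1, h2⟩ := Finset.mem_powersetCard.mp hT
      rw [← h2, ← Finset.prod_const]
      refine Finset.prod_congr rfl fun i hi => ?_
      have := (Finset.mem_filter.mp (h1 hi)).2
      rw [lam_eq_ite, if_neg this]
      norm_num
    · intro T hT hT'
      have hc := (Finset.mem_powersetCard.mp hT).2
      obtain ⟨i, hi, hi'⟩ : ∃ i ∈ T, tr (a * v i) = 0 := by
        by_contra! hcon
        exact hT' (Finset.mem_powersetCard.mpr ⟨fun i hi => by simpa using hcon i hi, hc⟩)
      exact Finset.prod_eq_zero hi (by rw [lam_eq_ite, if_pos hi']; norm_num)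
  have hE (a : F) : ∑ i, lam (a * v i) - N =
      -2 * ((Finset.univ.filter fun i => tr (a * v i) ≠ 0).card : ℤ) := by
    rw [← hN, ← Finset.card_univ, Finset.card_eq_sum_ones, Finset.card_filter]
    push_cast
    rw [← Finset.sum_sub_distrib, Finset.mul_sum]
    refine Finset.sum_congr rfl fun i _ => ?_
    rw [lam_eq_ite]
    split_ifs <;> simp_all
  have hpow (a : F) : (∑ i, lam (a * v i) - N) ^ h = ∑ t ∈ Finset.range (h + 1),
      (t ! : ℤ) * (Nat.stirlingSecond h t : ℤ) * (-2) ^ (h - t) *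
        ∑ T ∈ (Finset.univ : Finset ι).powersetCard t, ∏ i ∈ T, (lam (a * v i) - 1) := by
    rw [hE, mul_pow, ← Nat.cast_pow, pow_eq_sum_stirlingSecond]
    push_cast
    rw [Finset.mul_sum]
    refine Finset.sum_congr rfl fun t ht => ?_
    rw [hprod, show (-2 : ℤ) ^ h = (-2) ^ (h - t) * (-2) ^ t by
      rw [← pow_add, Nat.sub_add_cancel (by simpa [Nat.lt_succ_iff] using ht)]]
    ring
  simp_rw [hpow]
  rw [Finset.sum_comm]
  simp_rw [← Finset.mul_sum, sum_prod_sub_one hF, hN]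
  -- No word has weight above the length `N`, so the range of `j` may be extended to `h`.
  rw [Finset.sum_subset (Finset.range_mono (Nat.succ_le_succ (min_le_right N h)))
    (f := fun j => (-1 : ℤ) ^ (h + j) * (weightCount (binaryCode v) j : ℤ) *
      ∑ t ∈ Finset.Icc j h, (t ! : ℤ) * (Nat.stirlingSecond h t : ℤ) * 2 ^ (h - t) *
        binom ((N : ℤ) - j) ((N : ℤ) - t)) fun j hj hj' => by
    rw [weightCount_eq_zero_of_lt v (by simp at hj hj'; omega)]; simp]
  simp_rw [Finset.mul_sum]
  rw [Finset.sum_comm' (t' := Finset.range (h + 1)) (s' := fun j => Finset.Icc j h)]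
  · refine Finset.sum_congr rfl fun j _ => Finset.sum_congr rfl fun t ht => ?_
    obtain ⟨hjt, hth⟩ := Finset.mem_Icc.mp ht
    rcases le_or_gt j N with hjN | hjN
    · rw [binom_sub_sub hjN hjt, neg_pow (2 : ℤ) (h - t)]
      have : (-1 : ℤ) ^ (h - t) * (-1) ^ (t + j) = (-1) ^ (h + j) := by
        rw [← pow_add]; congr 1; omega
      rw [← this]
      ring
    · rw [weightCount_eq_zero_of_lt v (by omega)]
      simp
  · intro t j
    simp only [Finset.mem_range, Finset.mem_Icc]
    omega

end Codes

section Units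

variable {F : Type*} [Field F] [Fintype F] [DecidableEq F]

theorem prod_eq_zero_mul_prod_units {M : Type*} [CommMonoid M] (f : F → M) :
    ∏ x, f x = f 0 * ∏ x : Fˣ, f x := by
  rw [mul_comm]
  exact (sum_units_add (M := Additive M) fun x => Additive.ofMul (f x)).symm

theorem card_pi_units (k : ℕ) :
    (Fintype.card (Fin k → Fˣ) : ℤ) = ((Fintype.card F : ℤ) - 1) ^ k := by
  rw [Fintype.card_fun, Fintype.card_fin, Nat.cast_pow, card_units_int]

end Units

/-! ### Weight counts from fibre sizes -/

section Families

variable {F : Type*} [Field F] [Fintype F] [DecidableEq F] [Algebra (ZMod 2) F]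
  {ι : Type*} [Fintype ι]

/-- The number of coordinates at which `v` takes the value `β`. -/
def fiberCard (v : ι → F) (β : F) : ℕ := (Finset.univ.filter fun i => v i = β).card

/-- Fourier inversion on `F`; the frequency `0` contributes `Fintype.card ι`. -/
theorem card_mul_fiberCard (v : ι → F) (β : F) :
    (Fintype.card F : ℤ) * fiberCard v β =
      Fintype.card ι + ∑ x : Fˣ, lam (β * x) * ∑ i, lam (x * v i) := by
  have := charP_two F
  have h := sum_units_add fun x : F => lam (β * x) * ∑ i, lam (x * v i)
  simp only [mul_zero, lam_zero, zero_mul, one_mul, Finset.sum_const, Finset.card_univ,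
    nsmul_eq_mul, mul_one] at h
  rw [add_comm, h]
  simp_rw [Finset.mul_sum]
  rw [Finset.sum_comm, fiberCard, Finset.card_filter]
  push_cast
  rw [Finset.mul_sum]
  refine Finset.sum_congr rfl fun i _ => ?_
  simp_rw [mul_comm _ (v i), ← lam_add, ← add_mul]
  rw [sum_lam_mul]
  simp only [CharTwo.add_eq_zero, eq_comm (a := β)]
  split_ifs <;> simp

variable [DecidableEq ι]

/-- Let `ν β` count the points of a support in the fibre of `v` over `β`. The zero-sum condition
depends only on `ν`, and for given `ν` the points are chosen independently in each fibre. -/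
theorem weightCount_eq_sum_families (v : ι → F) (j : ℕ) :
    weightCount (binaryCode v) j =
      ∑ ν ∈ families (Finset.univ : Finset F) j, ∏ β, (fiberCard v β).choose (ν β) := by
  have hsum (J : Finset ι) : ∑ i ∈ J, v i =
      ∑ β, ((J.filter fun i => v i = β).card : F) * β := by
    rw [← Finset.sum_fiberwise J v v]
    refine Finset.sum_congr rfl fun β _ => ?_
    rw [Finset.sum_congr rfl fun i hi => (Finset.mem_filter.mp hi).2, Finset.sum_const,
      nsmul_eq_mul]
  rw [weightCount_eq_card, Finset.card_eq_sum_card_fiberwise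
    (f := fun J β => (J.filter fun i => v i = β).card) (t := families Finset.univ j)]
  · refine Finset.sum_congr rfl fun ν hν => ?_
    simp only [families, Finset.mem_filter, Finset.mem_piAntidiag, Finset.mem_univ, implies_true,
      and_true] at hν
    simp_rw [fiberCard, ← Finset.card_powersetCard, ← Fintype.card_piFinset]
    refine Finset.card_nbij' (fun J β => J.filter fun i => v i = β)
      (fun f => Finset.univ.filter fun i => i ∈ f (v i)) ?_ ?_ ?_ ?_
    · intro J hJ
      have hJ' := (Finset.mem_filter.mp hJ).2
      refine Finset.mem_coe.mpr (Fintype.mem_piFinset.mpr fun β => ?_)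
      rw [Finset.mem_powersetCard]
      exact ⟨Finset.filter_subset_filter _ (Finset.subset_univ J), congrFun hJ' β⟩
    · intro f hf
      have hf' (β : F) := Finset.mem_powersetCard.mp (Fintype.mem_piFinset.mp hf β)
      have hfib (β : F) :
          ((Finset.univ.filter fun i => i ∈ f (v i)).filter fun i => v i = β) = f β := by
        ext i
        simp only [Finset.mem_filter, Finset.mem_univ, true_and]
        refine ⟨fun h => h.2 ▸ h.1, fun h => ?_⟩
        have := (Finset.mem_filter.mp ((hf' β).1 h)).2
        exact ⟨this.symm ▸ h, this⟩
      simp only [Finset.coe_filter, Finset.mem_filter, Finset.mem_powersetCard,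
        Finset.subset_univ, true_and, Set.mem_ofPred_eq]
      have hcard : (fun β => (((Finset.univ.filter fun i => i ∈ f (v i)).filter
          fun i => v i = β)).card) = ν := funext fun β => by rw [hfib, (hf' β).2]
      refine ⟨⟨?_, ?_⟩, hcard⟩
      · rw [Finset.card_eq_sum_card_fiberwise (f := v) (t := Finset.univ) (by simp), ← hν.1]
        exact Finset.sum_congr rfl fun β _ => congrFun hcard β
      · rw [hsum, ← hν.2]
        exact Finset.sum_congr rfl fun β _ => by rw [← congrFun hcard β]
    · intro J _
      ext i
      simp
    · intro f hf
      have hf' (β : F) := Finset.mem_powersetCard.mp (Fintype.mem_piFinset.mp hf β)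
      funext β
      ext i
      simp only [Finset.mem_filter, Finset.mem_univ, true_and]
      refine ⟨fun h => h.2 ▸ h.1, fun h => ?_⟩
      have := (Finset.mem_filter.mp ((hf' β).1 h)).2
      exact ⟨this.symm ▸ h, this⟩
  · intro J hJ
    obtain ⟨hJ, hs⟩ := Finset.mem_filter.mp hJ
    simp only [families, Finset.coe_filter, Finset.mem_piAntidiag, Finset.mem_univ, implies_true,
      and_true, Set.mem_ofPred_eq]
    rw [← hsum, hs]
    refine ⟨?_, rfl⟩
    rw [← (Finset.mem_powersetCard.mp hJ).2,
      Finset.card_eq_sum_card_fiberwise (f := v) (t := Finset.univ) (by simp)]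

theorem weightCount_eq_sum_families_of_support (v : ι → F) (j : ℕ) (S : Finset F)
    (hS : ∀ β ∉ S, fiberCard v β = 0) :
    weightCount (binaryCode v) j =
      ∑ ν ∈ families S j, ∏ β ∈ S, (fiberCard v β).choose (ν β) := by
  rw [weightCount_eq_sum_families, ← Finset.sum_subset (s₁ := families S j)]
  · refine Finset.sum_congr rfl fun ν hν => ?_
    simp only [families, Finset.mem_filter, Finset.mem_piAntidiag] at hν
    refine (Finset.prod_subset (Finset.subset_univ S) fun β _ hβ => ?_).symm
    rw [show ν β = 0 from by_contra fun h => hβ (hν.1.2 β h), Nat.choose_zero_right]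
  · intro ν hν
    simp only [families, Finset.mem_filter, Finset.mem_piAntidiag, Finset.mem_univ, implies_true,
      and_true] at hν ⊢
    have h0 : ∀ β ∉ S, ν β = 0 := fun β hβ => by_contra fun h => hβ (hν.1.2 β h)
    rw [← hν.1.1, ← hν.2]
    exact ⟨(Finset.sum_subset (Finset.subset_univ S) fun β _ hβ => h0 β hβ).symm,
      (Finset.sum_subset (Finset.subset_univ S) fun β _ hβ => by simp [h0 β hβ]).symm⟩
  · intro ν hν hν'
    simp only [families, Finset.mem_filter, Finset.mem_piAntidiag, Finset.mem_univ, implies_true,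
      and_true] at hν hν'
    obtain ⟨β, hβ, hβS⟩ : ∃ β, ν β ≠ 0 ∧ β ∉ S := by
      by_contra! hcon
      have h0 : ∀ β ∉ S, ν β = 0 := fun β hβ => by_contra fun h => hβ (hcon β h)
      refine hν' ⟨⟨?_, hcon⟩, ?_⟩
      · rw [← hν.1]
        exact Finset.sum_subset (Finset.subset_univ S) fun β _ hβ => h0 β hβ
      · rw [← hν.2]
        exact Finset.sum_subset (Finset.subset_univ S) fun β _ hβ => by simp [h0 β hβ]
    refine Finset.prod_eq_zero (Finset.mem_univ β) ?_
    rw [hS β hβS, Nat.choose_eq_zero_of_lt (Nat.pos_of_ne_zero hβ)]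

/-- The Weil bound and the congruence mod 4 ensure that the grouping by `t` omits no `β`. -/
theorem prod_valueRange {r : ℕ} (hr : 2 ≤ r) (hF : Fintype.card F = 2 ^ r) (G : ℤ → Fˣ → ℤ) :
    ∏ t ∈ valueRange (2 ^ r), ∏ β : Fˣ with K 1 β⁻¹ = t, G t β = ∏ β : Fˣ, G (K 1 β⁻¹) β := by
  rw [← Finset.prod_fiberwise_of_maps_to (g := fun β : Fˣ => K 1 β⁻¹) (t := valueRange (2 ^ r))
    fun β _ => K_one_mem_valueRange hr hF β⁻¹]
  refine Finset.prod_congr rfl fun t _ => Finset.prod_congr rfl fun β hβ => ?_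
  rw [(Finset.mem_filter.mp hβ).2]

end Families

/-! ### Kloosterman identities and fibre sizes -/

section KloostermanIdentities

variable {F : Type*} [Field F] [Fintype F] [DecidableEq F] [Algebra (ZMod 2) F]

theorem K_zero (a : Fˣ) : K 0 a = lam (a : F) := by
  simp [K]

/-- Squaring is additive, permutes the units and preserves `lam`. -/
theorem K_sq (m : ℕ) (a : Fˣ) : K m (a ^ 2) = K m a := by
  have := charP_two F
  have hinj : Function.Injective fun x : Fˣ => x ^ 2 := fun x y h => by
    have h' : (x : F) ^ 2 = (y : F) ^ 2 := by exact_mod_cast congrArg Units.val h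
    exact Units.ext (CharTwo.sq_injective h')
  have hbij : Function.Bijective fun (α : Fin m → Fˣ) i => α i ^ 2 :=
    Finite.injective_iff_bijective.mp fun α α' h => funext fun i => hinj (congrFun h i)
  unfold K
  refine (Function.Bijective.sum_comp hbij _).symm.trans (Finset.sum_congr rfl fun α _ => ?_)
  rw [← lam_sq (∑ i, (α i : F) + _), CharTwo.add_sq, CharTwo.sum_sq, mul_pow, ← Finset.prod_pow]
  simp [inv_pow]

theorem K_pow_two_pow (m s : ℕ) (a : Fˣ) : K m (a ^ 2 ^ s) = K m a := by
  induction s with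
  | zero => simp
  | succ s ih => rw [pow_succ, pow_mul, K_sq, ih]

/-- Replacing each `α i` by `x⁻¹ * α i` clears `x` from the sum and turns the factor `x` of the
inverse product into `x ^ (k + 1)`. -/
theorem sum_lam_codeC (k : ℕ) (x : Fˣ) :
    ∑ α : Fin k → Fˣ, lam ((x : F) * (∑ i, (α i : F) + ∏ i, (α i : F)⁻¹)) = K k (x ^ (k + 1)) := by
  unfold K
  refine Fintype.sum_equiv (Equiv.piCongrRight fun _ => Equiv.mulLeft x) _ _ fun α => ?_
  simp only [Equiv.piCongrRight_apply, Pi.map_apply, Equiv.coe_mulLeft, Units.val_mul, mul_inv,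
    Finset.prod_mul_distrib, Finset.prod_const, Finset.card_univ, Fintype.card_fin, mul_add,
    Finset.mul_sum, Units.val_pow_eq_pow_val]
  congr 2
  rw [pow_succ', ← mul_assoc, mul_assoc (x : F), ← mul_pow, mul_inv_cancel₀ x.ne_zero, one_pow,
    mul_one]

theorem sum_lam_sum (k : ℕ) : ∑ α : Fin k → Fˣ, lam (∑ i, (α i : F)) = (-1) ^ k := by
  simp_rw [lam_sum]
  rw [← Fintype.sum_pow (fun x : Fˣ => lam (x : F)), sum_units_lam]

/-- The product condition determines one coordinate from the other `m`, and that coordinate becomes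
the last term in the Kloosterman sum. -/
theorem sum_lam_of_prod_inv_eq (m : ℕ) (β : Fˣ) :
    ∑ α : Fin (m + 1) → Fˣ, (if (β : F) = ∏ i, (α i : F)⁻¹ then lam (∑ i, (α i : F)) else 0) =
      K m β⁻¹ := by
  rw [← Fintype.sum_equiv (Fin.consEquiv fun _ => Fˣ) (fun p => if (β : F) = (p.1 : F)⁻¹ *
    ∏ i, (p.2 i : F)⁻¹ then lam ((p.1 : F) + ∑ i, (p.2 i : F)) else 0) _ fun p => by
      simp [Fin.prod_univ_succ, Fin.sum_univ_succ, Fin.consEquiv, mul_comm],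
    Fintype.sum_prod_type_right, K]
  refine Finset.sum_congr rfl fun α _ => ?_
  rw [Finset.sum_eq_single (β⁻¹ * ∏ i, (α i)⁻¹)]
  · rw [if_pos]
    · simp [add_comm, Units.coe_prod]
    · have : ∏ i, (α i : F) ≠ 0 := Finset.prod_ne_zero_iff.mpr fun i _ => (α i).ne_zero
      simp [Units.coe_prod]
      field_simp
  · intro x _ hx
    refine if_neg fun h => hx ?_
    apply Units.ext
    simp only [Units.val_mul, Units.coe_prod, Units.val_inv_eq_inv_val, h]
    rw [mul_inv, inv_inv, mul_assoc, inv_mul_cancel₀, mul_one]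
    exact Finset.prod_ne_zero_iff.mpr fun i _ => inv_ne_zero (α i).ne_zero
  · simp

theorem sum_lam_mul_K (k : ℕ) (β : F) :
    ∑ x : Fˣ, lam (β * x) * K k x = Fintype.card F * (∑ α : Fin k → Fˣ,
      if β = ∏ i, (α i : F)⁻¹ then lam (∑ i, (α i : F)) else 0) - (-1) ^ k := by
  have := charP_two F
  simp_rw [K, Finset.mul_sum]
  rw [Finset.sum_comm, ← sum_lam_sum (F := F), ← Finset.sum_sub_distrib]
  refine Finset.sum_congr rfl fun α _ => ?_
  have (x : Fˣ) : lam (β * (x : F)) * lam (∑ i, (α i : F) + (x : F) * ∏ i, (α i : F)⁻¹) =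
      lam (∑ i, (α i : F)) * lam ((β + ∏ i, (α i : F)⁻¹) * x) := by
    rw [← lam_add, ← lam_add]
    congr 1
    ring
  simp_rw [this]
  rw [← Finset.mul_sum, sum_units_lam_mul]
  simp only [CharTwo.add_eq_zero]
  split_ifs <;> ring

theorem sum_lam_mul_K_unit (m : ℕ) (β : Fˣ) :
    ∑ x : Fˣ, lam ((β : F) * x) * K (m + 1) x = Fintype.card F * K m β⁻¹ + (-1) ^ m := by
  rw [sum_lam_mul_K, sum_lam_of_prod_inv_eq]; ring

theorem sum_lam_zero_mul_K (k : ℕ) :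
    ∑ x : Fˣ, lam ((0 : F) * x) * K k x = - (-1) ^ k := by
  rw [sum_lam_mul_K, Finset.sum_eq_zero, mul_zero, zero_sub]
  intro α _
  rw [if_neg]
  exact (Finset.prod_ne_zero_iff.mpr fun i _ => inv_ne_zero (α i).ne_zero).symm

theorem card_mul_fiberCard_codeC {k s : ℕ} (hk : k + 1 = 2 ^ s) (β : F) :
    (Fintype.card F : ℤ) *
        fiberCard (fun α : Fin k → Fˣ => ∑ i, (α i : F) + ∏ i, (α i : F)⁻¹) β =
      ((Fintype.card F : ℤ) - 1) ^ k + ∑ x : Fˣ, lam (β * x) * K k x := by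
  rw [card_mul_fiberCard, card_pi_units]
  simp_rw [sum_lam_codeC, hk, K_pow_two_pow]

theorem fiberCard_codeC_one_zero :
    (fiberCard (fun α : Fin 1 → Fˣ => ∑ i, (α i : F) + ∏ i, (α i : F)⁻¹) 0 : ℤ) = 1 := by
  apply mul_left_cancel₀ (Nat.cast_ne_zero.mpr (Fintype.card_ne_zero (α := F)))
  rw [card_mul_fiberCard_codeC (s := 1) rfl, sum_lam_zero_mul_K]
  ring

theorem fiberCard_codeC_one_unit (β : Fˣ) :
    (fiberCard (fun α : Fin 1 → Fˣ => ∑ i, (α i : F) + ∏ i, (α i : F)⁻¹) β : ℤ) =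
      1 + lam (β : F)⁻¹ := by
  apply mul_left_cancel₀ (Nat.cast_ne_zero.mpr (Fintype.card_ne_zero (α := F)))
  rw [card_mul_fiberCard_codeC (s := 1) rfl, sum_lam_mul_K_unit, K_zero, Units.val_inv_eq_inv_val]
  ring

/-- Carlitz's identity `K(a)² = K₂(a) + q`. -/
theorem K_one_sq (a : Fˣ) : K 1 a ^ 2 = K 2 a + Fintype.card F := by
  have := charP_two F
  -- With `y = x * u` in the double sum for `K 1 a ^ 2` and `s = x * (1 + u)` for `u ≠ 1`, the inner
  -- sum depends only on `u + u⁻¹`. The value `β ≠ 0` is taken `1 + lam β⁻¹` times: the `1` part is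
  -- handled by `∑ β, G β = 0`, the other part is `K 2 a`.
  let G : F → ℤ := fun β => ∑ s : Fˣ, lam ((s : F) + a * β * (s : F)⁻¹)
  have hG0 : G 0 = -1 := by simp [G, sum_units_lam]
  have hprod : K 1 a ^ 2 =
      ∑ u : Fˣ, ∑ x : Fˣ, lam ((x : F) * (1 + u) + a * (1 + u) * ((x : F) * u)⁻¹) := by
    rw [sq, K_one, Finset.sum_mul_sum, Finset.sum_comm' (t' := Finset.univ)
      (s' := fun _ => Finset.univ) (by simp)]
    rw [Finset.sum_comm]
    conv_rhs => rw [Finset.sum_comm]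
    refine Finset.sum_congr rfl fun x _ => ?_
    refine Fintype.sum_equiv (Equiv.mulLeft x⁻¹) _ _ fun y => ?_
    rw [← lam_add]
    congr 1
    simp only [Equiv.coe_mulLeft, Units.val_mul, Units.val_inv_eq_inv_val]
    field_simp
    ring
  have hinner (u : Fˣ) (hu : u ≠ 1) :
      ∑ x : Fˣ, lam ((x : F) * (1 + u) + a * (1 + u) * ((x : F) * u)⁻¹) =
        G ((u : F) + (u : F)⁻¹) := by
    have h1 : (1 + u : F) ≠ 0 := by
      rw [Ne, CharTwo.add_eq_zero]
      exact fun h => hu (Units.ext (by simpa using h.symm))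
    refine Fintype.sum_equiv (Equiv.mulRight (Units.mk0 _ h1)) _ _ fun x => ?_
    simp only [Equiv.coe_mulRight, Units.val_mul, Units.val_mk0]
    congr 2
    have h2 : (u : F) + (u : F)⁻¹ = (1 + u) ^ 2 * (u : F)⁻¹ := by
      rw [CharTwo.add_sq]
      field_simp
      ring
    rw [h2]
    field_simp
  have hone : ∑ x : Fˣ, lam ((x : F) * (1 + (1 : Fˣ)) + a * (1 + (1 : Fˣ)) *
      ((x : F) * (1 : Fˣ))⁻¹) = Fintype.card F - 1 := by
    rw [← card_units_int]
    simp [CharTwo.add_self_eq_zero]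
  have hfib : ∑ u : Fˣ, G ((u : F) + (u : F)⁻¹) = ∑ β : F,
      (fiberCard (fun α : Fin 1 → Fˣ => ∑ i, (α i : F) + ∏ i, (α i : F)⁻¹) β : ℤ) * G β := by
    rw [← Fintype.sum_equiv (Equiv.funUnique (Fin 1) Fˣ) (fun α : Fin 1 → Fˣ =>
      G (∑ i, (α i : F) + ∏ i, (α i : F)⁻¹)) _ fun α => by simp,
      ← Finset.sum_fiberwise Finset.univ
        (fun α : Fin 1 → Fˣ => ∑ i, (α i : F) + ∏ i, (α i : F)⁻¹)]
    refine Finset.sum_congr rfl fun β _ => ?_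
    rw [Finset.sum_congr rfl fun α hα => congrArg G (Finset.mem_filter.mp hα).2, Finset.sum_const,
      nsmul_eq_mul, fiberCard]
  have hGsum : ∑ β : F, G β = 0 := by
    simp only [G]
    rw [Finset.sum_comm]
    refine Finset.sum_eq_zero fun s _ => ?_
    have (β : F) : lam ((s : F) + a * β * (s : F)⁻¹) =
        lam (s : F) * lam ((a : F) * (s : F)⁻¹ * β) := by
      rw [← lam_add]; congr 1; ring
    simp_rw [this]
    rw [← Finset.mul_sum, sum_lam_mul, if_neg (by simp), mul_zero]
  have hK2 : ∑ β : Fˣ, lam (β : F)⁻¹ * G β = K 2 a := by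
    simp only [G, Finset.mul_sum]
    rw [← Fintype.sum_prod_type', K]
    refine Fintype.sum_equiv (((Equiv.inv Fˣ).prodCongr (Equiv.refl Fˣ)).trans
      (finTwoArrowEquiv Fˣ).symm) _ _ fun p => ?_
    rw [← lam_add]
    simp [finTwoArrowEquiv, Fin.sum_univ_two, Fin.prod_univ_two]
    ring_nf
  -- The substitution fails at `u = 1`, where the inner sum is `q - 1` instead of `G 0`.
  have hsplit : ∑ u : Fˣ, ∑ x : Fˣ, lam ((x : F) * (1 + u) + a * (1 + u) * ((x : F) * u)⁻¹) =
      (Fintype.card F - 1) + (∑ u : Fˣ, G ((u : F) + (u : F)⁻¹) - G 0) := by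
    rw [← Finset.add_sum_erase _ _ (Finset.mem_univ (1 : Fˣ)), hone,
      ← Finset.add_sum_erase _ (fun u : Fˣ => G ((u : F) + (u : F)⁻¹)) (Finset.mem_univ (1 : Fˣ)),
      Finset.sum_congr rfl fun u hu => hinner u (Finset.ne_of_mem_erase hu)]
    simp [CharTwo.add_self_eq_zero]
  rw [hprod, hsplit, hfib, ← sum_units_add, fiberCard_codeC_one_zero]
  simp_rw [fiberCard_codeC_one_unit, add_mul, one_mul, Finset.sum_add_distrib]
  rw [hK2]
  rw [← sum_units_add] at hGsum
  linarith

theorem fiberCard_codeC_three_zero :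
    (fiberCard (fun α : Fin 3 → Fˣ => ∑ i, (α i : F) + ∏ i, (α i : F)⁻¹) 0 : ℤ) =
      (Fintype.card F : ℤ) ^ 2 - 3 * Fintype.card F + 3 := by
  apply mul_left_cancel₀ (Nat.cast_ne_zero.mpr (Fintype.card_ne_zero (α := F)))
  rw [card_mul_fiberCard_codeC (s := 2) rfl, sum_lam_zero_mul_K]
  ring

theorem fiberCard_codeC_three_unit (β : Fˣ) :
    (fiberCard (fun α : Fin 3 → Fˣ => ∑ i, (α i : F) + ∏ i, (α i : F)⁻¹) β : ℤ) =
      K 1 β⁻¹ ^ 2 + (Fintype.card F : ℤ) ^ 2 - 4 * Fintype.card F + 3 := by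
  apply mul_left_cancel₀ (Nat.cast_ne_zero.mpr (Fintype.card_ne_zero (α := F)))
  rw [card_mul_fiberCard_codeC (s := 2) rfl, sum_lam_mul_K_unit, K_one_sq]
  ring

/-- The two coordinates separate, and each contributes `K 1 (x ^ 2) = K 1 x`. -/
theorem sum_lam_codeD (x : Fˣ) :
    ∑ α : Fin 2 → Fˣ, lam ((x : F) * (∑ i, (α i : F) + ∑ i, (α i : F)⁻¹)) = K 1 x ^ 2 := by
  rw [← K_sq 1 x, show x ^ 2 = x ^ (1 + 1) from rfl, ← sum_lam_codeC 1 x,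
    Fintype.sum_equiv (Equiv.funUnique (Fin 1) Fˣ) _
      (fun y : Fˣ => lam ((x : F) * ((y : F) + (y : F)⁻¹))) fun α => by simp, Fintype.sum_pow]
  refine Finset.sum_congr rfl fun α _ => ?_
  rw [← lam_sum, ← Finset.mul_sum, Finset.sum_add_distrib]

theorem card_mul_fiberCard_codeD (β : F) :
    (Fintype.card F : ℤ) *
        fiberCard (fun α : Fin 2 → Fˣ => ∑ i, (α i : F) + ∑ i, (α i : F)⁻¹) β =
      ((Fintype.card F : ℤ) - 1) ^ 2 + ∑ x : Fˣ, lam (β * x) * K 2 x +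
        Fintype.card F * ((if β = 0 then (Fintype.card F : ℤ) else 0) - 1) := by
  rw [card_mul_fiberCard, card_pi_units]
  simp_rw [sum_lam_codeD, K_one_sq, mul_add, Finset.sum_add_distrib]
  rw [← Finset.sum_mul, sum_units_lam_mul]
  ring

theorem fiberCard_codeD_zero :
    (fiberCard (fun α : Fin 2 → Fˣ => ∑ i, (α i : F) + ∑ i, (α i : F)⁻¹) 0 : ℤ) =
      2 * Fintype.card F - 3 := by
  apply mul_left_cancel₀ (Nat.cast_ne_zero.mpr (Fintype.card_ne_zero (α := F)))
  rw [card_mul_fiberCard_codeD, sum_lam_zero_mul_K, if_pos rfl]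
  ring

theorem fiberCard_codeD_unit (β : Fˣ) :
    (fiberCard (fun α : Fin 2 → Fˣ => ∑ i, (α i : F) + ∑ i, (α i : F)⁻¹) β : ℤ) =
      K 1 β⁻¹ + Fintype.card F - 3 := by
  apply mul_left_cancel₀ (Nat.cast_ne_zero.mpr (Fintype.card_ne_zero (α := F)))
  rw [card_mul_fiberCard_codeD, sum_lam_mul_K_unit, if_neg β.ne_zero]
  ring

end KloostermanIdentities

section Units

variable {F : Type*} [Field F] [Fintype F] [DecidableEq F] {q : ℕ}

theorem card_pi_units_nat (hF : Fintype.card F = q) (k : ℕ) :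
    Fintype.card (Fin k → Fˣ) = (q - 1) ^ k := by
  rw [Fintype.card_fun, Fintype.card_fin, Fintype.card_units, hF]

theorem cast_sub_one_pow (hF : Fintype.card F = q) (k : ℕ) :
    (((q - 1) ^ k : ℕ) : ℤ) = ((q : ℤ) - 1) ^ k := by
  rw [← card_pi_units_nat hF, card_pi_units, hF]

end Units

/-! ### Assembling the moment recursions and weight formulas -/

section Moments

variable {F : Type*} [Field F] [Fintype F] [DecidableEq F] [Algebra (ZMod 2) F]

/-- The term `a = 0` is `(N - N) ^ h`, which vanishes because `h ≥ 1`. -/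
theorem sum_units_sub_card_pow {ι : Type*} [Fintype ι] [DecidableEq ι] {q N : ℕ}
    (hF : Fintype.card F = q) (hN : Fintype.card ι = N) {v : ι → F} {g : Fˣ → ℤ}
    (hg : ∀ x : Fˣ, ∑ i, lam ((x : F) * v i) = g x) {h : ℕ} (hh : 1 ≤ h) :
    ∑ x : Fˣ, (g x - N) ^ h = q * ∑ j ∈ Finset.range (min N h + 1),
      (-1) ^ (h + j) * (weightCount (binaryCode v) j : ℤ) *
        ∑ t ∈ Finset.Icc j h, (t ! : ℤ) * (Nat.stirlingSecond h t : ℤ) * 2 ^ (h - t) *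
          binom ((N : ℤ) - j) ((N : ℤ) - t) := by
  rw [← sum_charSum_sub_card_pow hF hN v h,
    ← sum_units_add fun a : F => (∑ i, lam (a * v i) - (N : ℤ)) ^ h]
  simp_rw [hg]
  simp [hN, Nat.one_le_iff_ne_zero.mp hh]

theorem weightCount_eq_sum_binom {ι : Type*} [Fintype ι] [DecidableEq ι] {v : ι → F} {m : ℤ}
    {g : Fˣ → ℤ} (h0 : (fiberCard v 0 : ℤ) = m) (hg : ∀ β : Fˣ, (fiberCard v β : ℤ) = g β)
    (j : ℕ) :
    (weightCount (binaryCode v) j : ℤ) = ∑ ν ∈ families (Finset.univ : Finset F) j,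
      binom m (ν 0) * ∏ β : Fˣ, binom (g β) (ν β) := by
  rw [weightCount_eq_sum_families]
  push_cast
  refine Finset.sum_congr rfl fun ν _ => ?_
  simp_rw [← binom_natCast]
  rw [prod_eq_zero_mul_prod_units, h0]
  simp_rw [hg]

theorem MK_eq_of_codeC {q k s : ℕ} (hF : Fintype.card F = q) (hk : k + 1 = 2 ^ s) {h : ℕ}
    (hh : 1 ≤ h) :
    MK F k h =
      ∑ l ∈ Finset.range h,
        (-1) ^ (h + l + 1) * (h.choose l : ℤ) * (((q : ℤ) - 1) ^ k) ^ (h - l) * MK F k l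
      + (q : ℤ) * ∑ j ∈ Finset.range (min ((q - 1) ^ k) h + 1),
          (-1) ^ (h + j) * (weightCount (codeC F k) j : ℤ) *
            ∑ t ∈ Finset.Icc j h, (t ! : ℤ) * (Nat.stirlingSecond h t : ℤ) * 2 ^ (h - t) *
              binom (((q : ℤ) - 1) ^ k - j) (((q : ℤ) - 1) ^ k - t) := by
  have := sum_units_sub_card_pow hF (card_pi_units_nat hF k) (g := K k)
    (v := fun α : Fin k → Fˣ => ∑ i, (α i : F) + ∏ i, (α i : F)⁻¹)
    (fun x => by rw [sum_lam_codeC, hk, K_pow_two_pow]) hh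
  rw [cast_sub_one_pow hF] at this
  exact sum_pow_eq_of_sum_sub_pow_eq _ _ _ _ this

theorem sum_units_pow_codeD {q h : ℕ} (hF : Fintype.card F = q) (hh : 1 ≤ h) :
    ∑ x : Fˣ, (K 1 x ^ 2 - ((q : ℤ) - 1) ^ 2) ^ h =
      (q : ℤ) * ∑ j ∈ Finset.range (min ((q - 1) ^ 2) h + 1),
          (-1) ^ (h + j) * (weightCount (codeD F 2) j : ℤ) *
            ∑ t ∈ Finset.Icc j h, (t ! : ℤ) * (Nat.stirlingSecond h t : ℤ) * 2 ^ (h - t) *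
              binom (((q : ℤ) - 1) ^ 2 - j) (((q : ℤ) - 1) ^ 2 - t) := by
  have := sum_units_sub_card_pow hF (card_pi_units_nat hF 2) (g := fun x => K 1 x ^ 2)
    (v := fun α : Fin 2 → Fˣ => ∑ i, (α i : F) + ∑ i, (α i : F)⁻¹) sum_lam_codeD hh
  rwa [cast_sub_one_pow hF] at this

theorem weightCount_codeC_one (j : ℕ) :
    (weightCount (codeC F 1) j : ℤ) = ∑ ν ∈ families (insert 0 (traceZero F)) j,
      binom 1 (ν 0) * ∏ β ∈ traceZero F, binom 2 (ν β) := by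
  have h0 : (0 : F) ∉ traceZero F := by simp [traceZero]
  have hfib (β : F) (hβ : β ≠ 0) :=
    fiberCard_codeC_one_unit (Units.mk0 β hβ)
  simp only [Units.val_mk0, lam_eq_ite] at hfib
  rw [codeC, weightCount_eq_sum_families_of_support _ j (insert 0 (traceZero F))]
  · push_cast
    refine Finset.sum_congr rfl fun ν _ => ?_
    simp_rw [← binom_natCast]
    rw [Finset.prod_insert h0, fiberCard_codeC_one_zero]
    congr 1
    refine Finset.prod_congr rfl fun β hβ => ?_
    obtain ⟨hβ0, hβ⟩ := (Finset.mem_filter.mp hβ).2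
    rw [hfib β hβ0, if_pos hβ]
    norm_num
  -- At a nonzero `β` with `tr β⁻¹ = 1` the fibre has size `1 + lam β⁻¹ = 0`.
  · intro β hβ
    simp only [traceZero, Finset.mem_insert, Finset.mem_filter, Finset.mem_univ, true_and,
      not_or, not_and] at hβ
    have := hfib β hβ.1
    rw [if_neg (hβ.2 hβ.1)] at this
    simpa using this

end Moments

end KloostermanMoments

open KloostermanMoments in
theorem corollary2 {F : Type*} [Field F] [Fintype F] [DecidableEq F] [Algebra (ZMod 2) F]
    (q r : ℕ) (hq : q = 2 ^ r) (hr : 3 ≤ r) (hF : Fintype.card F = q) :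
    -- (1)
    ((∀ h : ℕ, 1 ≤ h →
        MK F 1 h =
          ∑ l ∈ Finset.range h,
            (-1) ^ (h + l + 1) * (h.choose l : ℤ) * ((q : ℤ) - 1) ^ (h - l) * MK F 1 l
          + (q : ℤ) * ∑ j ∈ Finset.range (min (q - 1) h + 1),
              (-1) ^ (h + j) * (weightCount (codeC F 1) j : ℤ) *
                ∑ t ∈ Finset.Icc j h, (t ! : ℤ) * (Nat.stirlingSecond h t : ℤ) * 2 ^ (h - t) *
                  binom ((q : ℤ) - 1 - j) ((q : ℤ) - 1 - t)) ∧
      (∀ j : ℕ, j ≤ q - 1 →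
        (weightCount (codeC F 1) j : ℤ) =
          ∑ ν ∈ families (insert 0 (traceZero F)) j,
            binom 1 (ν 0) * ∏ β ∈ traceZero F, binom 2 (ν β))) ∧
    -- (2)
    ((∀ h : ℕ, 1 ≤ h →
        MK F 3 h =
          ∑ l ∈ Finset.range h,
            (-1) ^ (h + l + 1) * (h.choose l : ℤ) * ((q : ℤ) - 1) ^ (3 * (h - l)) * MK F 3 l
          + (q : ℤ) * ∑ j ∈ Finset.range (min ((q - 1) ^ 3) h + 1),
              (-1) ^ (h + j) * (weightCount (codeC F 3) j : ℤ) *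
                ∑ t ∈ Finset.Icc j h, (t ! : ℤ) * (Nat.stirlingSecond h t : ℤ) * 2 ^ (h - t) *
                  binom (((q : ℤ) - 1) ^ 3 - j) (((q : ℤ) - 1) ^ 3 - t)) ∧
      (∀ j : ℕ, j ≤ (q - 1) ^ 3 →
        (weightCount (codeC F 3) j : ℤ) =
          ∑ ν ∈ families (Finset.univ : Finset F) j,
            binom ((q : ℤ) ^ 2 - 3 * q + 3) (ν 0) *
              ∏ t ∈ valueRange q, ∏ β : Fˣ with K 1 β⁻¹ = t,
                binom (t ^ 2 + (q : ℤ) ^ 2 - 4 * q + 3) (ν β))) ∧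
    -- (3)
    ((∀ h : ℕ, 1 ≤ h →
        MK F 1 (2 * h) =
          ∑ l ∈ Finset.range h,
            (-1) ^ (h + l + 1) * (h.choose l : ℤ) * ((q : ℤ) - 1) ^ (2 * (h - l)) *
              MK F 1 (2 * l)
          + (q : ℤ) * ∑ j ∈ Finset.range (min ((q - 1) ^ 2) h + 1),
              (-1) ^ (h + j) * (weightCount (codeD F 2) j : ℤ) *
                ∑ t ∈ Finset.Icc j h, (t ! : ℤ) * (Nat.stirlingSecond h t : ℤ) * 2 ^ (h - t) *
                  binom (((q : ℤ) - 1) ^ 2 - j) (((q : ℤ) - 1) ^ 2 - t)) ∧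
      (∀ j : ℕ, j ≤ (q - 1) ^ 2 →
        (weightCount (codeD F 2) j : ℤ) =
          ∑ ν ∈ families (Finset.univ : Finset F) j,
            binom (2 * (q : ℤ) - 3) (ν 0) *
              ∏ β : Fˣ, binom (K 1 β⁻¹ + (q : ℤ) - 3) (ν β) ∧
        (weightCount (codeD F 2) j : ℤ) =
          ∑ ν ∈ families (Finset.univ : Finset F) j,
            binom (2 * (q : ℤ) - 3) (ν 0) *
              ∏ t ∈ valueRange q, ∏ β : Fˣ with K 1 β⁻¹ = t,
                binom (t + (q : ℤ) - 3) (ν β))) ∧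
    -- (4)
    (∀ h : ℕ, 1 ≤ h →
        MK F 2 h =
          ∑ l ∈ Finset.range h,
            (-1) ^ (h + l + 1) * (h.choose l : ℤ) * ((q : ℤ) ^ 2 - 3 * q + 1) ^ (h - l) *
              MK F 2 l
          + (q : ℤ) * ∑ j ∈ Finset.range (min ((q - 1) ^ 2) h + 1),
              (-1) ^ (h + j) * (weightCount (codeD F 2) j : ℤ) *
                ∑ t ∈ Finset.Icc j h, (t ! : ℤ) * (Nat.stirlingSecond h t : ℤ) * 2 ^ (h - t) *
                  binom (((q : ℤ) - 1) ^ 2 - j) (((q : ℤ) - 1) ^ 2 - t)) := by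
  subst hq
  have hr2 : 2 ≤ r := by omega
  refine ⟨⟨fun h hh => ?_, fun j _ => weightCount_codeC_one j⟩, ⟨fun h hh => ?_, fun j _ => ?_⟩,
    ⟨fun h hh => ?_, fun j _ => ?_⟩, fun h hh => ?_⟩
  · simpa only [pow_one] using MK_eq_of_codeC hF (k := 1) (s := 1) rfl hh
  · simpa only [← pow_mul] using MK_eq_of_codeC hF (k := 3) (s := 2) rfl hh
  · rw [codeC, weightCount_eq_sum_binom fiberCard_codeC_three_zero fiberCard_codeC_three_unit, hF]
    refine Finset.sum_congr rfl fun ν _ => ?_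
    rw [prod_valueRange hr2 hF fun t β =>
      binom (t ^ 2 + ((2 ^ r : ℕ) : ℤ) ^ 2 - 4 * (2 ^ r : ℕ) + 3) (ν β)]
  · have := sum_pow_eq_of_sum_sub_pow_eq _ _ _ _ (sum_units_pow_codeD hF hh)
    simpa only [MK, ← pow_mul] using this
  · have key := weightCount_eq_sum_binom (F := F) fiberCard_codeD_zero fiberCard_codeD_unit j
    rw [hF] at key
    refine ⟨key, key.trans (Finset.sum_congr rfl fun ν _ => ?_)⟩
    rw [prod_valueRange hr2 hF fun t β => binom (t + ((2 ^ r : ℕ) : ℤ) - 3) (ν β)]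
  -- By Carlitz's identity, `K 2 x - (q² - 3q + 1) = K 1 x ^ 2 - (q - 1)²`, so the `codeD` moments
  -- apply unchanged.
  · refine sum_pow_eq_of_sum_sub_pow_eq _ _ _ _ ((Finset.sum_congr rfl fun x _ => ?_).trans
      (sum_units_pow_codeD hF hh))
    rw [K_one_sq, hF]
    ring
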